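/- **Setting.** Let $D\ge 1$, $K\ge 3$, $T\ge 1$. There are $K$ arms and $D$ users. User $d$ prefers arm $i$ to arm $j$ with probability $\mathcal P_{d,i,j}\in[0,1]$, where $\mathcal P_{d,i,j}+\mathcal P_{d,j,i}=1$ (so $\mathcal P_{d,i,i}=\tfrac12$), and every user $d$ has a Condorcet winner $a_d^*$: $\mathcal P_{d,a_d^*,j}>\tfrac12$ for all $j\ne a_d^*$. Put $\mathcal A^*=\{a_d^*: d\in[D]\}$ and assume $\Delta=\min_{d,\,i\ne j}|\tfrac12-\mathcal P_{d,i,j}|>0$. In round $t$ the agent chooses policies $\pi_t,\pi_t'\in\Delta^K$, plays independent arms $a_t\sim\pi_t$, $a_t'\sim\pi_t'$, and observes a fresh vector $\mathbf y_t\in\{0,1\}^D$ with $\Pr(y_t[d]=1\mid a_t=i,a'_t=j)=\mathcal P_{d,i,j}$. With scores $s_d(a)=2\mathcal P_{d,a,a_d^*}$ and $\mathrm{NSW}(\pi,s)=\prod_{d}\sum_a\pi(a)s_d(a)$, the expected regret is $\mathbb E[R_T]=\mathbb E\sum_{t=1}^T\bigl(\max_\pi \mathrm{NSW}(\pi,s)-\tfrac12(\mathrm{NSW}(\pi_t,s)+\mathrm{NSW}(\pi'_t,s))\bigr)$.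 **Algorithm** Fair-$\epsilon$-Greedy with confidence $\delta$ and rates $\epsilon_t$, stopped after $T$ rounds. *Identification phase* (modified DKW tournament with confidence $\delta/D$). Start with $S_d=[K]$ for all $d$ and $R(i,j)=1$ for all pairs $\{i,j\}$. While some $|S_d|>1$, choose such a $d$ and distinct $i,j\in S_d$ and run the following comparison as long as $i,j\in S_d$: for $r=R(i,j)$, $h_r=2^{-(r+1)}$, $\delta_r=\frac{6\delta}{DK\pi^2r^2}$, play the duel $(i,j)$ $N_r=\lceil 8\log(4/\delta_r)/h_r^2\rceil$ times; for each user $d'$ with $i,j\in S_{d'}$, let $\hat p_{d'}$ be the fraction of these duels in which $d'$ preferred $i$, and if $|\hat p_{d'}-\frac12|>h_r/2$ remove $j$ (if $\hat p_{d'}>\frac12$) or $i$ (otherwise) from $S_{d'}$; increase $R(i,j)$ by one. Let $T_0$ be the number of rounds used, and $\hat a_d^*$ the single element of $S_d$ at the end. *Main loop*, rounds $t>T_0$. Let $\hat{\mathcal P}_d(a,b)$ be the fraction of the duels between $a\neq b$ played since round $T_0$ that user $d$ decided for $a$ ($0$ if there are none), and $\hat{\mathcal P}_d(a,a)=\frac12$.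 Draw $u$ uniformly from $[0,1]$. If $u\le\epsilon_t$, play the next pair of a round-robin schedule over the pairs $(a,b)$ with $b\in\{\hat a^*_1,\dots,\hat a^*_D\}$, $a\neq b$ (so $\pi_t,\pi'_t$ are point masses). Otherwise put $\pi_t=\pi_t'=\hat\pi_t$ for some maximizer $\hat\pi_t$ of $\pi\mapsto\prod_d\sum_a 2\pi(a)\hat{\mathcal P}_d(a,\hat a_d^*)$ over $\Delta^K$. **Theorem.** For all constants $0<c_1\le c_2$ there is a constant $C>0$, depending on $c_1,c_2$ only, with the following property. Let $\hat\Delta\in(0,1)$, let $\delta=\frac{K\log(K/2)}{2\hat\Delta T}$ satisfy $\delta<1$, and let $\epsilon_t$ be a function of $t-T_0$ that lies between $c_1$ and $c_2$ times $$D^{2/3}K^{1/3}|\mathcal A^*|^{1/3}(t-T_0)^{-1/3}\log^{1/3}(DK(t-T_0)).$$ Then, in the setting above and for any way of making the choices that the algorithm leaves open (next comparison, order of the round-robin schedule, maximizer), the expected regret of Fair-$\epsilon$-Greedy satisfies $$\mathbb E[R_T]\le C\left(\frac{KD}{\Delta^2}\log\Bigl(\frac K2\Bigr)\left[\log\log\Bigl(\frac1\Delta\Bigr)+\log\left(\frac{2\hat\Delta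 TD}{K\log(K/2)}\right)\right]+D^{2/3}K^{1/3}|\mathcal A^*|^{1/3}T^{2/3}\log^{1/3}(DKT)+\frac{K\log(K/2)}{\hat\Delta}\right).$$ -/

import Mathlib

noncomputable section

namespace FairDuel

/-- A multi-user dueling bandit instance with `D` users and `K` arms. `pref d i j` is the probability
that user `d` prefers arm `i` to arm `j`; taking `i = j` in `pref_add` gives `pref d i i = 1 / 2`.
`feedback i j` is the law of the feedback vector of a duel `(i, j)`, whose entry `d` is `true` iff
user `d` prefers `i`. Only its one-user marginals are prescribed; the dependence between the users
is arbitrary. -/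
structure Instance (D K : ℕ) where
  pref : Fin D → Fin K → Fin K → ℝ
  pref_mem : ∀ d i j, pref d i j ∈ Set.Icc (0 : ℝ) 1
  pref_add : ∀ d i j, pref d i j + pref d j i = 1
  feedback : Fin K → Fin K → PMF (Fin D → Bool)
  feedback_marginal : ∀ d i j,
    ((feedback i j).map fun y => y d) true = ENNReal.ofReal (pref d i j)

/-- Arm `a` is the Condorcet winner of user `d`. -/
def Instance.IsCondorcetWinner {D K : ℕ} (I : Instance D K) (d : Fin D) (a : Fin K) : Prop :=
  ∀ j, j ≠ a → 1 / 2 < I.pref d a j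

/-- The minimum preference gap `min_{d, i ≠ j} |1/2 - pref d i j|`. -/
def Instance.minGap {D K : ℕ} (I : Instance D K) : ℝ :=
  ⨅ x : {x : Fin D × Fin K × Fin K // x.2.1 ≠ x.2.2}, |1 / 2 - I.pref x.1.1 x.1.2.1 x.1.2.2|

/-- The score of arm `a` for user `d`, relative to the arm `w d` (the Condorcet winner of `d`). -/
def Instance.score {D K : ℕ} (I : Instance D K) (w : Fin D → Fin K) (d : Fin D) (a : Fin K) : ℝ :=
  2 * I.pref d a (w d)

/-- Nash social welfare of a policy `π` (a probability vector on the arms) for the scores `s`. -/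
def nsw {D K : ℕ} (π : PMF (Fin K)) (s : Fin D → Fin K → ℝ) : ℝ :=
  ∏ d, ∑ a, (π a).toReal * s d a

/-- `π` is a policy of maximal Nash social welfare for the scores `s`. -/
def IsOptimal {D K : ℕ} (π : PMF (Fin K)) (s : Fin D → Fin K → ℝ) : Prop :=
  ∀ π' : PMF (Fin K), nsw π' s ≤ nsw π s

/-- What happens in one round: the outcome of the coin of the agent (`true` means: explore), the
two arms played, and the feedback vector. -/
structure Round (D K : ℕ) where
  coin : Bool
  fst : Fin K
  snd : Fin K
  y : Fin D → Bool

/-- Histories are lists of rounds, the most recent round first. -/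
abbrev History (D K : ℕ) := List (Round D K)

/-- An agent: given the history it tosses a coin, and given the history and the coin it chooses the
two policies from which the two arms of the round are sampled. -/
structure Agent (D K : ℕ) where
  coin : History D K → PMF Bool
  policies : History D K → Bool → PMF (Fin K) × PMF (Fin K)

/-- The law of the history of the first `n` rounds: in every round the coin is tossed, the two arms
are sampled independently from the two policies, and the feedback is drawn from the instance. -/
def Agent.law {D K : ℕ} (A : Agent D K) (I : Instance D K) : ℕ → PMF (History D K)
  | 0 => PMF.pure []
  | n + 1 =>
    (A.law I n).bind fun h =>
      (A.coin h).bind fun c =>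
        (A.policies h c).1.bind fun a =>
          (A.policies h c).2.bind fun b =>
            (I.feedback a b).map fun y => (⟨c, a, b, y⟩ : Round D K) :: h

/-- Total regret along a history, when the scores are `s` and the optimal policy is `πs`. -/
def Agent.regret {D K : ℕ} (A : Agent D K) (s : Fin D → Fin K → ℝ) (πs : PMF (Fin K)) :
    History D K → ℝ
  | [] => 0
  | o :: h => Agent.regret A s πs h +
      (nsw πs s - (nsw (A.policies h o.coin).1 s + nsw (A.policies h o.coin).2 s) / 2)

/-- The expected total regret up to the horizon `T`. -/
def Agent.expectedRegret {D K : ℕ} (A : Agent D K) (I : Instance D K)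
    (s : Fin D → Fin K → ℝ) (πs : PMF (Fin K)) (T : ℕ) : ℝ :=
  ∑' h : History D K, (A.law I T h).toReal * A.regret s πs h

/-! ### The identification phase -/

/-- The confidence width `h_r` of round `r` of a comparison. -/
def width (r : ℕ) : ℝ := (1 / 2) ^ (r + 1)

/-- The number of duels in round `r` of a comparison with confidence `δ'`, that is
`⌈8 log (4 / δ_r) / h_r ^ 2⌉` with `δ_r = 6 δ' / (π ^ 2 r ^ 2)`. -/
def batchSize (δ' : ℝ) (r : ℕ) : ℕ :=
  ⌈8 * Real.log (4 / (6 * δ' / (Real.pi ^ 2 * (r : ℝ) ^ 2))) / width r ^ 2⌉₊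

/-- The internal state of the algorithm. -/
structure State (D K : ℕ) where
  /-- the candidate sets of the users -/
  cand : Fin D → Finset (Fin K)
  /-- the round trackers of the pairs of arms -/
  tracker : Sym2 (Fin K) → ℕ
  /-- the comparison in progress, if any: the calling user and the two arms -/
  call : Option (Fin D × Fin K × Fin K)
  /-- the feedback vectors obtained so far in the current round of this comparison -/
  batch : List (Fin D → Bool)
  /-- the rounds played after the identification phase, the most recent first -/
  main : List (Round D K)

/-- The initial state. -/
def State.init (D K : ℕ) : State D K where
  cand := fun _ => Finset.univ
  tracker := fun _ => 1
  call := none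
  batch := []
  main := []

/-- The identification phase runs as long as some user has more than one candidate. -/
def State.Identifying {D K : ℕ} (σ : State D K) : Prop := ∃ d, 1 < (σ.cand d).card

/-- The candidate set of user `d` after a round of the comparison of `i` and `j` of confidence width
`h`, in which the feedback vectors `ys` were observed. -/
def eliminate {D K : ℕ} (h : ℝ) (i j : Fin K) (ys : List (Fin D → Bool)) (d : Fin D)
    (S : Finset (Fin K)) : Finset (Fin K) :=
  let p : ℝ := (ys.countP fun y => y d) / (ys.length : ℝ)
  if i ∈ S ∧ j ∈ S ∧ h / 2 < |p - 1 / 2| then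
    (if 1 / 2 < p then S.erase j else S.erase i)
  else S

/-- The choices that the algorithm leaves open. `pick` selects the calling user and the two arms of
the next comparison, `order` fixes the order of a round robin schedule over a finite set of pairs,
and `best` selects a maximizer of the Nash social welfare. -/
structure Choices (D K : ℕ) where
  pick : History D K → (Fin D → Finset (Fin K)) → Fin D × Fin K × Fin K
  pick_spec : ∀ h S, (∃ d, 1 < (S d).card) →
    (pick h S).2.1 ∈ S (pick h S).1 ∧ (pick h S).2.2 ∈ S (pick h S).1 ∧
      (pick h S).2.1 ≠ (pick h S).2.2
  order : Finset (Fin K × Fin K) → List (Fin K × Fin K)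
  order_nodup : ∀ Q, (order Q).Nodup
  mem_order : ∀ Q x, x ∈ order Q ↔ x ∈ Q
  best : History D K → (Fin D → Fin K → ℝ) → PMF (Fin K)
  best_spec : ∀ h s, IsOptimal (best h s) s

/-- The comparison to which the next duel of the identification phase belongs. -/
def currentCall {D K : ℕ} (R : Choices D K) (h : History D K) (σ : State D K) :
    Fin D × Fin K × Fin K :=
  σ.call.getD (R.pick h σ.cand)

open Classical in
/-- The state after a duel of the identification phase with feedback `y`, for comparisons with
confidence `δ'`. When a round of the comparison is complete, the candidate sets of all users who
still have both arms are updated, and the comparison goes on iff the calling user still has both. -/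
def identify {D K : ℕ} (R : Choices D K) (δ' : ℝ) (h : History D K) (σ : State D K)
    (y : Fin D → Bool) : State D K :=
  let c := currentCall R h σ
  let r := σ.tracker s(c.2.1, c.2.2)
  let ys := y :: σ.batch
  if ys.length < batchSize δ' r then
    { σ with call := some c, batch := ys }
  else
    let cand' := fun d => eliminate (width r) c.2.1 c.2.2 ys d (σ.cand d)
    { cand := cand'
      tracker := Function.update σ.tracker s(c.2.1, c.2.2) (r + 1)
      call := if c.2.1 ∈ cand' c.1 ∧ c.2.2 ∈ cand' c.1 then some c else none
      batch := []
      main := σ.main }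

open Classical in
/-- The state of the algorithm after a history, when it is run with confidence `δ`: the
identification tournament gets confidence `δ / D`, and each of its comparisons `δ / D / K`. -/
def stateAfter {D K : ℕ} (R : Choices D K) (δ : ℝ) : History D K → State D K
  | [] => State.init D K
  | o :: h =>
    let σ := stateAfter R δ h
    if σ.Identifying then identify R (δ / D / K) h σ o.y
    else { σ with main := o :: σ.main }

/-! ### The main loop -/

/-- The estimated Condorcet winner of user `d`: the single element of the candidate set. -/
def State.winner {D K : ℕ} [NeZero K] (σ : State D K) (d : Fin D) : Fin K :=
  if hne : (σ.cand d).Nonempty then (σ.cand d).min' hne else 0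

/-- The number of duels between `a` and `b` (in either order) in the list `l`. -/
def duels {D K : ℕ} (l : List (Round D K)) (a b : Fin K) : ℕ :=
  l.countP fun o => decide ((o.fst = a ∧ o.snd = b) ∨ (o.fst = b ∧ o.snd = a))

/-- The number of those duels in which user `d` preferred `a`. -/
def wins {D K : ℕ} (l : List (Round D K)) (d : Fin D) (a b : Fin K) : ℕ :=
  l.countP fun o => decide ((o.fst = a ∧ o.snd = b ∧ o.y d = true) ∨
    (o.fst = b ∧ o.snd = a ∧ o.y d = false))

/-- The empirical preference: `1 / 2` (known) on the diagonal, the fraction of won duels off the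
diagonal, and `0` as long as the pair has not been played. -/
def empiricalPref {D K : ℕ} (l : List (Round D K)) (d : Fin D) (a b : Fin K) : ℝ :=
  if a = b then 1 / 2 else (wins l d a b : ℝ) / (duels l a b : ℝ)

/-- The empirical scores. -/
def State.empiricalScore {D K : ℕ} [NeZero K] (σ : State D K) (d : Fin D) (a : Fin K) : ℝ :=
  2 * empiricalPref σ.main d a (σ.winner d)

/-- The pairs `(a, b)` with `b` an estimated Condorcet winner and `a ≠ b`. -/
def State.pairs {D K : ℕ} [NeZero K] (σ : State D K) : Finset (Fin K × Fin K) :=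
  Finset.univ.filter fun x => x.1 ≠ x.2 ∧ ∃ d, x.2 = σ.winner d

/-- The next pair of the round robin schedule: exploration number `n` (from `0` on) plays the pair
at position `n` modulo the number of pairs. -/
def nextPair {D K : ℕ} [NeZero K] (R : Choices D K) (σ : State D K) : Fin K × Fin K :=
  (R.order σ.pairs).getD ((σ.main.countP fun o => o.coin) % (R.order σ.pairs).length) (0, 0)

/-- The law of the indicator of `u ≤ p`, for `u` uniform in `[0, 1]`. -/
def uniformLE (p : ℝ) : PMF Bool :=
  let q : ENNReal := min 1 (ENNReal.ofReal p)
  PMF.ofFintype (fun b => if b = true then q else 1 - q) (by simp [q])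

open Classical in
/-- The algorithm Fair-ε-Greedy with confidence `δ` and exploration rates `ε`, where `ε n` is the
rate in the `n`-th round after the identification phase. -/
def fairEpsGreedy {D K : ℕ} [NeZero K] (R : Choices D K) (δ : ℝ) (ε : ℕ → ℝ) : Agent D K where
  coin := fun h =>
    let σ := stateAfter R δ h
    if σ.Identifying then PMF.pure false else uniformLE (ε (σ.main.length + 1))
  policies := fun h c =>
    let σ := stateAfter R δ h
    if σ.Identifying then
      (PMF.pure (currentCall R h σ).2.1, PMF.pure (currentCall R h σ).2.2)
    else if c = true then
      (PMF.pure (nextPair R σ).1, PMF.pure (nextPair R σ).2)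
    else
      (R.best h σ.empiricalScore, R.best h σ.empiricalScore)

/-- The order of the exploration rate in the `n`-th round after the identification phase, for `m`
distinct Condorcet winners. -/
def exploreOrder (D K m n : ℕ) : ℝ :=
  (D : ℝ) ^ (2 / 3 : ℝ) * (K : ℝ) ^ (1 / 3 : ℝ) * (m : ℝ) ^ (1 / 3 : ℝ) *
    (n : ℝ) ^ (-(1 / 3) : ℝ) * Real.log ((D : ℝ) * K * n) ^ (1 / 3 : ℝ)

end FairDuel

end

noncomputable section

namespace FairDuel

open scoped ENNReal

/-! ### Expectations under discrete laws -/

/-! Scores lie in `[0, 1]`, because they compare an arm with a Condorcet winner, so every round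
costs at most one. The regret is split into three parts (`sum_roundRegret_le`): identification
rounds of reliable histories, arbitrary rounds of unreliable histories, and main-loop rounds of
reliable histories.

Identification: a completed batch misleads a user if the empirical frequency is off by more than
half the width. An exponential supermartingale over the votes of the batch bounds the probability of
this by `(δ_r / 4) ^ 4`, and a union bound over pairs, users, directions and rounds gives `δ` in
total (`mean_not_reliable_le`), hence the cost `T δ`. If no batch misleads, Condorcet winners are
never removed, and a batch of width below `Δ` separates its two arms for all users at once
(`Reliable.sound`). So each comparison stops at the latest in the first round of width below `Δ`,
and it stops with an elimination for the calling user. There is room for fewer than `D K`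
eliminations before the phase ends, and the batch sizes grow geometrically, so the phase has length
of order `D K Δ⁻²` times a logarithm (`Reliable.length_lt_of_identifying`, `duelBudget_le`).

Main loop: write `e` for `exploreOrder` at round `N`. With high probability about `N e` explorations
have taken place, and round robin spreads them over at most `m K` pairs, so each relevant preference
is known up to `η ≈ sqrt (m K log (D K N) / (N e))`. The welfare, a product of `D` factors, is
Lipschitz with constant of order `D`, so exploiting costs `O(D η)`. The rate is chosen such that `D
η` and `e` balance (`sqrt_estimate`), and summing `e` over the rounds gives the `T ^ (2 / 3)` term.

The main loop starts at a random time. Its supermartingales are therefore run along the whole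
history and read off when the main loop has length `n` (`sum_mean_main_le`). Reliability is only
used pointwise and never conditioned on, so it does not disturb the laws of coins and votes.

In the final bound `log log (1 / Δ)` may be negative. `last_term_le` shows that the whole bound
still dominates a fixed fraction of its last term. -/

/-- The expectation of a nonnegative function under a discrete law. -/
def mean {α : Type*} (p : PMF α) (f : α → ℝ≥0∞) : ℝ≥0∞ := ∑' a, p a * f a

open Classical in
/-- The indicator of a proposition. -/
def ind (p : Prop) : ℝ≥0∞ := if p then 1 else 0

lemma ind_of {p : Prop} (h : p) : ind p = 1 := if_pos h

lemma ind_of_not {p : Prop} (h : ¬ p) : ind p = 0 := if_neg h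

lemma ind_le_one (p : Prop) : ind p ≤ 1 := by
  unfold ind
  split_ifs <;> simp

lemma ind_mono {p q : Prop} (h : p → q) : ind p ≤ ind q := by
  by_cases hp : p
  · rw [ind_of hp, ind_of (h hp)]
  · rw [ind_of_not hp]
    exact zero_le

section mean

variable {α β : Type*}

lemma mean_pure (a : α) (f : α → ℝ≥0∞) : mean (PMF.pure a) f = f a := by
  classical
  unfold mean
  rw [tsum_eq_single a]
  · simp
  · intro b hb
    simp [PMF.pure_apply, hb]

lemma mean_bind (p : PMF α) (g : α → PMF β) (f : β → ℝ≥0∞) :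
    mean (p.bind g) f = mean p fun a => mean (g a) f := by
  unfold mean
  simp only [PMF.bind_apply, ← ENNReal.tsum_mul_right, ← ENNReal.tsum_mul_left]
  rw [ENNReal.tsum_comm]
  simp only [mul_assoc]

lemma mean_map (p : PMF α) (g : α → β) (f : β → ℝ≥0∞) :
    mean (p.map g) f = mean p fun a => f (g a) := by
  rw [← PMF.bind_pure_comp, mean_bind]
  simp [mean_pure]

lemma mean_mono (p : PMF α) {f g : α → ℝ≥0∞} (h : ∀ a, f a ≤ g a) : mean p f ≤ mean p g :=
  ENNReal.tsum_le_tsum fun a => mul_le_mul_right (h a) _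

lemma mean_mono_support (p : PMF α) {f g : α → ℝ≥0∞} (h : ∀ a ∈ p.support, f a ≤ g a) :
    mean p f ≤ mean p g := by
  refine ENNReal.tsum_le_tsum fun a => ?_
  by_cases ha : a ∈ p.support
  · exact mul_le_mul_right (h a ha) _
  · simp [(PMF.apply_eq_zero_iff p a).2 ha]

lemma mean_const (p : PMF α) (c : ℝ≥0∞) : mean p (fun _ => c) = c := by
  simp [mean, ENNReal.tsum_mul_right, p.tsum_coe]

lemma mean_add (p : PMF α) (f g : α → ℝ≥0∞) :
    mean p (fun a => f a + g a) = mean p f + mean p g := by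
  simp [mean, mul_add, ENNReal.tsum_add]

lemma mean_mul_left (p : PMF α) (c : ℝ≥0∞) (f : α → ℝ≥0∞) :
    mean p (fun a => c * f a) = c * mean p f := by
  unfold mean
  rw [← ENNReal.tsum_mul_left]
  exact tsum_congr fun a => by ring

lemma mean_sum {ι : Type*} (p : PMF α) (s : Finset ι) (f : ι → α → ℝ≥0∞) :
    mean p (fun a => ∑ i ∈ s, f i a) = ∑ i ∈ s, mean p (f i) := by
  classical
  induction s using Finset.induction_on with
  | empty => simp [mean]
  | insert i s hi ih => simp [Finset.sum_insert hi, mean_add, ih]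

lemma mean_tsum {ι : Type*} (p : PMF α) (f : ι → α → ℝ≥0∞) :
    mean p (fun a => ∑' i, f i a) = ∑' i, mean p (f i) := by
  unfold mean
  simp only [← ENNReal.tsum_mul_left]
  rw [ENNReal.tsum_comm]

lemma mean_le_const (p : PMF α) {f : α → ℝ≥0∞} {c : ℝ≥0∞} (h : ∀ a, f a ≤ c) :
    mean p f ≤ c :=
  (mean_mono p h).trans (mean_const p c).le

lemma mean_bool (p : PMF Bool) (f : Bool → ℝ≥0∞) :
    mean p f = p true * f true + p false * f false := by
  simp [mean, add_comm]

end mean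

/-! ### The law of an agent -/

section law

variable {D K : ℕ} (A : Agent D K) (I : Instance D K)

/-- The law of the history after one more round. -/
def Agent.step (h : History D K) : PMF (History D K) :=
  (A.coin h).bind fun c =>
    (A.policies h c).1.bind fun a =>
      (A.policies h c).2.bind fun b =>
        (I.feedback a b).map fun y => (⟨c, a, b, y⟩ : Round D K) :: h

lemma Agent.law_succ (n : ℕ) : A.law I (n + 1) = (A.law I n).bind (A.step I) := rfl

lemma Agent.mean_step (h : History D K) (f : History D K → ℝ≥0∞) :
    mean (A.step I h) f = mean (A.coin h) fun c => mean (A.policies h c).1 fun a =>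
      mean (A.policies h c).2 fun b => mean (I.feedback a b) fun y =>
        f ((⟨c, a, b, y⟩ : Round D K) :: h) := by
  simp only [Agent.step, mean_bind, mean_map]

/-- The expected cumulative cost is at most the initial value of a potential that decreases on
average by at least the cost of the round. -/
lemma Agent.sum_mean_law_le (U f : History D K → ℝ≥0∞)
    (hU : ∀ h, mean (A.step I h) U + f h ≤ U h) (T : ℕ) :
    ∑ t ∈ Finset.range T, mean (A.law I t) f + mean (A.law I T) U ≤ U [] := by
  induction T with
  | zero => simp [Agent.law, mean_pure]
  | succ n ih =>
    refine le_trans (le_of_eq ?_) (le_trans (add_le_add_right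
      (mean_mono (A.law I n) hU) (∑ t ∈ Finset.range n, mean (A.law I t) f)) ih)
    rw [Finset.sum_range_succ, Agent.law_succ, mean_bind, mean_add]
    ring

/-- A supermartingale has mean at most its initial value. -/
lemma Agent.mean_law_le (U : History D K → ℝ≥0∞)
    (hU : ∀ h, mean (A.step I h) U ≤ U h) (T : ℕ) : mean (A.law I T) U ≤ U [] :=
  le_trans le_add_self (A.sum_mean_law_le I U (fun _ => 0) (by simpa using hU) T)

/-- The regret of a round that is played after history `h` with coin `c`. -/
def Agent.gap (s : Fin D → Fin K → ℝ) (πs : PMF (Fin K)) (h : History D K) (c : Bool) : ℝ :=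
  nsw πs s - (nsw (A.policies h c).1 s + nsw (A.policies h c).2 s) / 2

variable {s : Fin D → Fin K → ℝ} {πs : PMF (Fin K)}

lemma Agent.gap_nonneg (hπs : IsOptimal πs s) (h : History D K) (c : Bool) :
    0 ≤ A.gap s πs h c := by
  have h1 := hπs (A.policies h c).1
  have h2 := hπs (A.policies h c).2
  unfold Agent.gap
  linarith

lemma Agent.regret_nonneg (hπs : IsOptimal πs s) (h : History D K) : 0 ≤ A.regret s πs h := by
  induction h with
  | nil => simp [Agent.regret]
  | cons o h ih => exact add_nonneg ih (A.gap_nonneg hπs h o.coin)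

/-- The loss of a round depends only on the past and the coin, so averaging over arms and feedback
leaves it unchanged. Optimality of `πs` makes all losses nonnegative, which is what lets
`ENNReal.ofReal` distribute over the sum. -/
lemma Agent.mean_regret (hπs : IsOptimal πs s) (T : ℕ) :
    mean (A.law I T) (fun h => ENNReal.ofReal (A.regret s πs h)) =
      ∑ t ∈ Finset.range T, mean (A.law I t) fun h =>
        mean (A.coin h) fun c => ENNReal.ofReal (A.gap s πs h c) := by
  induction T with
  | zero => simp [Agent.law, mean_pure, Agent.regret]
  | succ n ih =>
    rw [Finset.sum_range_succ, ← ih, Agent.law_succ, mean_bind, ← mean_add]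
    congr 1
    funext h
    rw [Agent.mean_step]
    have : ∀ c a b y, ENNReal.ofReal (A.regret s πs ((⟨c, a, b, y⟩ : Round D K) :: h)) =
        ENNReal.ofReal (A.regret s πs h) + ENNReal.ofReal (A.gap s πs h c) := fun c a b y =>
      ENNReal.ofReal_add (A.regret_nonneg hπs h) (A.gap_nonneg hπs h c)
    simp only [this, mean_const, mean_add]

/-- Transfers the problem to `ℝ≥0∞`, where sums may be interchanged without summability conditions.
-/
lemma Agent.expectedRegret_le (hπs : IsOptimal πs s) (T : ℕ) {B : ℝ} (hB : 0 ≤ B)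
    (h : ∑ t ∈ Finset.range T, mean (A.law I t) (fun h =>
        mean (A.coin h) fun c => ENNReal.ofReal (A.gap s πs h c)) ≤ ENNReal.ofReal B) :
    A.expectedRegret I s πs T ≤ B := by
  have key : A.expectedRegret I s πs T =
      (mean (A.law I T) fun h => ENNReal.ofReal (A.regret s πs h)).toReal := by
    unfold mean Agent.expectedRegret
    rw [ENNReal.tsum_toReal_eq]
    · refine tsum_congr fun h => ?_
      rw [ENNReal.toReal_mul, ENNReal.toReal_ofReal (A.regret_nonneg hπs h)]
    · exact fun h => ENNReal.mul_ne_top (PMF.apply_ne_top _ _) ENNReal.ofReal_ne_top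
  rw [key, A.mean_regret I hπs]
  exact ENNReal.toReal_le_of_le_ofReal hB h

/-- Every later estimate looks at one user at a time, so the one-user marginals suffice and the
dependence between users plays no role. -/
lemma Instance.mean_feedback (i j : Fin K) (d : Fin D) (g : Bool → ℝ) (hg : ∀ b, 0 ≤ g b) :
    mean (I.feedback i j) (fun y => ENNReal.ofReal (g (y d))) =
      ENNReal.ofReal (I.pref d i j * g true + (1 - I.pref d i j) * g false) := by
  have h0 := I.feedback_marginal d i j
  have hp := I.pref_mem d i j
  have h1 : mean (I.feedback i j) (fun y => ENNReal.ofReal (g (y d))) =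
      mean ((I.feedback i j).map fun y => y d) fun b => ENNReal.ofReal (g b) := by
    rw [mean_map]
  have h2 := ((I.feedback i j).map fun y => y d).tsum_coe
  rw [tsum_bool, h0] at h2
  have h3 : ((I.feedback i j).map fun y => y d) false = ENNReal.ofReal (1 - I.pref d i j) := by
    rw [ENNReal.ofReal_sub _ hp.1, ENNReal.ofReal_one, ← h2]
    exact (ENNReal.add_sub_cancel_right ENNReal.ofReal_ne_top).symm
  rw [h1, mean_bool, h0, h3, ENNReal.ofReal_add, ENNReal.ofReal_mul hp.1, ENNReal.ofReal_mul]
  · linarith [hp.2]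
  · exact mul_nonneg hp.1 (hg _)
  · exact mul_nonneg (by linarith [hp.2]) (hg _)

end law

/-! ### Exponential moments of a coin -/

open MeasureTheory ProbabilityTheory in
/-- Hoeffding's lemma for a biased coin. -/
lemma bernoulli_mgf_le {p : ℝ} (hp : p ∈ Set.Icc (0 : ℝ) 1) (l : ℝ) :
    p * Real.exp (l * (1 - p)) + (1 - p) * Real.exp (l * (0 - p)) ≤ Real.exp (l ^ 2 / 8) := by
  -- The law of the coin as a mixture of point masses, so that Hoeffding's lemma for an interval of
  -- length one applies; its variance proxy `1 / 4` produces the `1 / 8`.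
  let μ : Measure ℝ := ENNReal.ofReal p • Measure.dirac 1 + ENNReal.ofReal (1 - p) • Measure.dirac 0
  have h1p : 0 ≤ 1 - p := by linarith [hp.2]
  have hμ : IsProbabilityMeasure μ := by
    constructor
    simp only [μ, Measure.coe_add, Pi.add_apply, Measure.smul_apply, measure_univ, smul_eq_mul,
      mul_one]
    rw [← ENNReal.ofReal_add hp.1 h1p]
    simp
  have hint : ∀ f : ℝ → ℝ, ∫ x, f x ∂μ = p * f 1 + (1 - p) * f 0 := by
    intro f
    have hi : ∀ (a q : ℝ), Integrable f (ENNReal.ofReal q • Measure.dirac a) := fun a q =>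
      (integrable_dirac (by simp)).smul_measure ENNReal.ofReal_ne_top
    rw [integral_add_measure (hi _ _) (hi _ _), integral_smul_measure, integral_smul_measure,
      integral_dirac, integral_dirac, ENNReal.toReal_ofReal hp.1, ENNReal.toReal_ofReal h1p]
    simp
  have hae : ∀ᵐ x ∂μ, id x ∈ Set.Icc (0 : ℝ) 1 := by
    simp only [μ, ae_add_measure_iff]
    constructor <;> refine Measure.ae_smul_measure ?_ _ <;> simp [ae_dirac_eq]
  have h := (hasSubgaussianMGF_of_mem_Icc (μ := μ) (X := id) aemeasurable_id hae).mgf_le l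
  simp only [mgf, hint] at h
  refine le_trans (le_of_eq ?_) (le_trans h (le_of_eq ?_))
  · simp
  · congr 1
    simp
    ring

/-- The compensated form, with `σ = ±1` covering both tails: multiplying a weight by this factor
keeps it a supermartingale. -/
lemma bernoulli_mgf_neg_le {p : ℝ} (hp : p ∈ Set.Icc (0 : ℝ) 1) (l σ : ℝ) (hσ : σ ^ 2 = 1) :
    p * Real.exp (l * (σ * (1 - p)) - l ^ 2 / 8) +
      (1 - p) * Real.exp (l * (σ * (0 - p)) - l ^ 2 / 8) ≤ 1 := by
  have h := bernoulli_mgf_le hp (l * σ)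
  rw [mul_pow, hσ, mul_one] at h
  rw [Real.exp_sub, Real.exp_sub, ← mul_div_assoc, ← mul_div_assoc, ← add_div,
    div_le_one (Real.exp_pos _), ← mul_assoc l, ← mul_assoc l]
  exact h

/-! ### One round of the algorithm -/

section step

variable {D K : ℕ} (R : Choices D K) (δ : ℝ)

lemma mean_step_identifying [NeZero K] (ε : ℕ → ℝ) (I : Instance D K) {h : History D K} (hI : (stateAfter R δ h).Identifying)
    (f : History D K → ℝ≥0∞) :
    mean ((fairEpsGreedy R δ ε).step I h) f =
      mean (I.feedback (currentCall R h (stateAfter R δ h)).2.1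
        (currentCall R h (stateAfter R δ h)).2.2) fun y =>
          f (⟨false, (currentCall R h (stateAfter R δ h)).2.1,
            (currentCall R h (stateAfter R δ h)).2.2, y⟩ :: h) := by
  rw [Agent.mean_step]
  simp [fairEpsGreedy, hI, mean_pure]

lemma stateAfter_cons_identifying {h : History D K} (hI : (stateAfter R δ h).Identifying)
    (o : Round D K) :
    stateAfter R δ (o :: h) = identify R (δ / D / K) h (stateAfter R δ h) o.y := by
  simp [stateAfter, hI]

lemma stateAfter_cons_not_identifying {h : History D K} (hI : ¬ (stateAfter R δ h).Identifying)
    (o : Round D K) :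
    stateAfter R δ (o :: h) =
      { stateAfter R δ h with main := o :: (stateAfter R δ h).main } := by
  simp [stateAfter, hI]

/-- A new comparison starts its batch from nothing, so the weight of a batch about to start is the
weight of the empty batch. -/
lemma batch_eq_nil_of_call_eq_none (h : History D K) :
    (stateAfter R δ h).call = none → (stateAfter R δ h).batch = [] := by
  induction h with
  | nil => intro; rfl
  | cons o h ih =>
    by_cases hI : (stateAfter R δ h).Identifying
    · rw [show stateAfter R δ (o :: h) = identify R (δ / D / K) h (stateAfter R δ h) o.y by
        simp [stateAfter, hI]]
      unfold identify
      dsimp only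
      split_ifs <;> simp
    · rw [show stateAfter R δ (o :: h) =
        { stateAfter R δ h with main := o :: (stateAfter R δ h).main } by simp [stateAfter, hI]]
      exact ih

/-- Outside the identification phase the candidate sets are frozen, so the phase cannot resume once
it has ended. -/
lemma main_eq_nil_of_identifying (h : History D K) :
    (stateAfter R δ h).Identifying → (stateAfter R δ h).main = [] := by
  induction h with
  | nil => intro; rfl
  | cons o h ih =>
    by_cases hI : (stateAfter R δ h).Identifying
    · intro _
      have : (stateAfter R δ (o :: h)).main = (stateAfter R δ h).main := by
        simp only [stateAfter, hI, if_true, identify]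
        split_ifs <;> rfl
      rw [this, ih hI]
    · intro h'
      simp only [stateAfter, hI, if_false] at h'
      exact absurd h' hI

end step

/-! ### Failures of the identification phase -/

section failure

variable {D K : ℕ} (R : Choices D K) (δ : ℝ) (I : Instance D K)

/-- The number of excess votes of user `d` for the first arm in a batch, when the preference
probability is `p`. -/
def excess (p : ℝ) (d : Fin D) (ys : List (Fin D → Bool)) : ℝ :=
  (ys.countP fun y => y d) - p * ys.length

lemma excess_cons (p : ℝ) (d : Fin D) (y : Fin D → Bool) (ys : List (Fin D → Bool)) :
    excess p d (y :: ys) = excess p d ys + ((if y d then 1 else 0) - p) := by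
  unfold excess
  rw [List.countP_cons, List.length_cons]
  push_cast
  ring

/-- In the last duel of the history, a round `r` of a comparison of `i` with `j` was completed, and
the empirical preference of user `d` was off by more than half the width, in direction `z`. -/
def FailsAt (i j : Fin K) (r : ℕ) (d : Fin D) (z : ℝ) (o : Round D K) (h : History D K) : Prop :=
  (stateAfter R δ h).Identifying ∧ (currentCall R h (stateAfter R δ h)).2 = (i, j) ∧
    (stateAfter R δ h).tracker s(i, j) = r ∧
    batchSize (δ / D / K) r ≤ (o.y :: (stateAfter R δ h).batch).length ∧
    width r / 2 * (o.y :: (stateAfter R δ h).batch).length <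
      z * excess (I.pref d i j) d (o.y :: (stateAfter R δ h).batch)

/-- `FailsAt` holds at some time of the history. -/
def Fails (i j : Fin K) (r : ℕ) (d : Fin D) (z : ℝ) : History D K → Prop
  | [] => False
  | o :: h => Fails i j r d z h ∨ FailsAt R δ I i j r d z o h

/-- The exponential weight of a partial batch. -/
def batchWeight (p : ℝ) (N r : ℕ) (d : Fin D) (z : ℝ) (ys : List (Fin D → Bool)) : ℝ :=
  Real.exp (2 * width r * (z * excess p d ys) - (2 * width r) ^ 2 / 8 * ys.length
    - N * width r ^ 2 / 2)

lemma width_pos (r : ℕ) : 0 < width r := by unfold width; positivity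

/-- The tilt `2 h` is the best one for a deviation of `h / 2` per vote: each vote earns `h ^ 2`, the
compensator takes back half of it, and the remaining `h ^ 2 / 2` per vote pays for the prefactor as
soon as there are `N` votes. -/
lemma one_le_batchWeight {p : ℝ} {N r : ℕ} {d : Fin D} {z : ℝ} {ys : List (Fin D → Bool)}
    (hN : N ≤ ys.length) (hz : width r / 2 * ys.length < z * excess p d ys) :
    1 ≤ batchWeight p N r d z ys := by
  unfold batchWeight
  apply Real.one_le_exp
  have hw := width_pos r
  have h1 : (N : ℝ) ≤ ys.length := by exact_mod_cast hN
  have h2 : width r ^ 2 * N ≤ width r ^ 2 * ys.length := by gcongr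
  have h3 : 2 * width r * (width r / 2 * ys.length) ≤ 2 * width r * (z * excess p d ys) := by
    gcongr
  nlinarith

lemma mean_batchWeight_le (i j : Fin K) (N r : ℕ) (d : Fin D) {z : ℝ} (hz : z ^ 2 = 1)
    (ys : List (Fin D → Bool)) :
    mean (I.feedback i j) (fun y =>
      ENNReal.ofReal (batchWeight (I.pref d i j) N r d z (y :: ys))) ≤
      ENNReal.ofReal (batchWeight (I.pref d i j) N r d z ys) := by
  have hsplit : ∀ y : Fin D → Bool, batchWeight (I.pref d i j) N r d z (y :: ys) =
      batchWeight (I.pref d i j) N r d z ys * Real.exp (2 * width r *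
        (z * ((if y d then 1 else 0) - I.pref d i j)) - (2 * width r) ^ 2 / 8) := by
    intro y
    unfold batchWeight
    rw [← Real.exp_add, excess_cons, List.length_cons]
    congr 1
    push_cast
    ring
  simp only [hsplit]
  rw [I.mean_feedback i j d (fun b => batchWeight (I.pref d i j) N r d z ys * Real.exp (2 * width r *
        (z * ((if b then 1 else 0) - I.pref d i j)) - (2 * width r) ^ 2 / 8))]
  · apply ENNReal.ofReal_le_ofReal
    have h := bernoulli_mgf_neg_le (I.pref_mem d i j) (2 * width r) z hz
    have hb : 0 ≤ batchWeight (I.pref d i j) N r d z ys := (Real.exp_pos _).le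
    simp only [if_true, Bool.false_eq_true, if_false]
    nlinarith
  · intro b
    unfold batchWeight
    positivity

open Classical in
/-- The potential that controls the probability of `Fails`. -/
def failPotential (i j : Fin K) (r : ℕ) (d : Fin D) (z : ℝ) (h : History D K) : ℝ≥0∞ :=
  let σ := stateAfter R δ h
  let N := batchSize (δ / D / K) r
  if Fails R δ I i j r d z h then 1
  else if σ.tracker s(i, j) = r ∧ σ.call.map Prod.snd = some (i, j) then
    ENNReal.ofReal (batchWeight (I.pref d i j) N r d z σ.batch)
  else if σ.tracker s(i, j) ≤ r then
    ENNReal.ofReal (batchWeight (I.pref d i j) N r d z [])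
  else 0

/-- A duel of the monitored round has three outcomes: the batch continues with its weight, it ends
in a failure and the weight is at least one, or it ends well, the tracker moves past `r`, and the
potential drops to zero. -/
lemma failPotential_cons_le_of_current {i j : Fin K} {r : ℕ} {d : Fin D} {z : ℝ}
    {h : History D K} (hI : (stateAfter R δ h).Identifying)
    (hc : (currentCall R h (stateAfter R δ h)).2 = (i, j))
    (ht : (stateAfter R δ h).tracker s(i, j) = r) (hf : ¬ Fails R δ I i j r d z h)
    (o : Round D K) :
    failPotential R δ I i j r d z (o :: h) ≤ ENNReal.ofReal (batchWeight (I.pref d i j)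
      (batchSize (δ / D / K) r) r d z (o.y :: (stateAfter R δ h).batch)) := by
  by_cases hl : (o.y :: (stateAfter R δ h).batch).length < batchSize (δ / D / K) r
  · have hnf : ¬ Fails R δ I i j r d z (o :: h) := by
      rintro (h1 | h1)
      · exact hf h1
      · exact absurd h1.2.2.2.1 (not_le.2 hl)
    have hs : stateAfter R δ (o :: h) = { stateAfter R δ h with
        call := some (currentCall R h (stateAfter R δ h)),
        batch := o.y :: (stateAfter R δ h).batch } := by
      simp only [stateAfter, hI, if_true, identify, hc, ht, hl]
    simp only [failPotential, hnf, if_false, hs, ht, true_and, Option.map_some, hc, if_true]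
    exact le_refl _
  · by_cases hfa : FailsAt R δ I i j r d z o h
    · have : Fails R δ I i j r d z (o :: h) := Or.inr hfa
      simp only [failPotential, this, if_true]
      rw [ENNReal.one_le_ofReal]
      exact one_le_batchWeight hfa.2.2.2.1 hfa.2.2.2.2
    · have hnf : ¬ Fails R δ I i j r d z (o :: h) := by
        rintro (h1 | h1)
        · exact hf h1
        · exact hfa h1
      have hs : (stateAfter R δ (o :: h)).tracker s(i, j) = r + 1 := by
        simp only [stateAfter, hI, if_true, identify, hc, ht, hl, if_false, Function.update_self]
      simp [failPotential, hnf, hs]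

/-- Trackers never decrease. Hence the monitored round can only go from waiting to waiting, to
started with an empty batch, or to past; the last also happens when round `r` of the pair is played
with the arms in the other order. -/
lemma failPotential_cons_le_of_not_current {i j : Fin K} {r : ℕ} {d : Fin D} {z : ℝ}
    {h : History D K} (hI : (stateAfter R δ h).Identifying)
    (hc : ¬ ((currentCall R h (stateAfter R δ h)).2 = (i, j) ∧
      (stateAfter R δ h).tracker s(i, j) = r)) (hf : ¬ Fails R δ I i j r d z h)
    (o : Round D K) :
    failPotential R δ I i j r d z (o :: h) ≤ failPotential R δ I i j r d z h := by
  have hnf : ¬ Fails R δ I i j r d z (o :: h) := by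
    rintro (h1 | h1)
    · exact hf h1
    · exact hc ⟨h1.2.1, h1.2.2.1⟩
  have hcall : ¬ ((stateAfter R δ h).tracker s(i, j) = r ∧
      (stateAfter R δ h).call.map Prod.snd = some (i, j)) := by
    rintro ⟨h1, h2⟩
    refine hc ⟨?_, h1⟩
    obtain ⟨c, hc1, hc2⟩ := Option.map_eq_some_iff.1 h2
    simp [currentCall, hc1, hc2]
  have htr : (stateAfter R δ h).tracker s(i, j) ≤ (stateAfter R δ (o :: h)).tracker s(i, j) := by
    simp only [stateAfter, hI, if_true, identify]
    split_ifs
    · exact le_refl _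
    all_goals
      simp only [Function.update_apply]
      split_ifs with h1
      · rw [h1]; exact Nat.le_succ _
      · exact le_refl _
  have hcall' : (stateAfter R δ (o :: h)).tracker s(i, j) = r ∧
      (stateAfter R δ (o :: h)).call.map Prod.snd = some (i, j) →
      (stateAfter R δ (o :: h)).batch = [] := by
    simp only [stateAfter, hI, if_true, identify]
    split_ifs with h1
    · simp only [Option.map_some, Option.some.injEq]
      exact fun h2 => absurd ⟨h2.2, h2.1⟩ hc
    all_goals exact fun _ => rfl
  unfold failPotential
  dsimp only
  rw [if_neg hnf, if_neg hf, if_neg hcall]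
  split_ifs with h1 h2 h3 h4
  · rw [hcall' h1]
  · exact absurd (htr.trans h1.1.le) h2
  · exact le_refl _
  · exact absurd (htr.trans h3) h4
  · exact zero_le
  · exact zero_le

variable [NeZero K] (ε : ℕ → ℝ)

/-- The potential is an upper bound for the conditional probability that the monitored batch ever
fails: one after a failure, the weight of the partial batch while it runs, the weight of the empty
batch beforehand, zero afterwards. A round `r` of a pair is completed at most once, so one batch is
all that must be tracked. -/
lemma mean_failPotential_le (i j : Fin K) (r : ℕ) (d : Fin D) {z : ℝ} (hz : z ^ 2 = 1)
    (h : History D K) :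
    mean ((fairEpsGreedy R δ ε).step I h) (failPotential R δ I i j r d z) ≤
      failPotential R δ I i j r d z h := by
  by_cases hf : Fails R δ I i j r d z h
  · rw [Agent.mean_step]
    have h1 : ∀ o, failPotential R δ I i j r d z (o :: h) = 1 := by
      intro o
      have : Fails R δ I i j r d z (o :: h) := Or.inl hf
      simp [failPotential, this]
    simp only [h1, mean_const]
    simp [failPotential, hf]
  by_cases hI : (stateAfter R δ h).Identifying
  · by_cases hc : (currentCall R h (stateAfter R δ h)).2 = (i, j) ∧
      (stateAfter R δ h).tracker s(i, j) = r
    · rw [mean_step_identifying R δ ε I hI]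
      refine le_trans (mean_mono _ fun y =>
        failPotential_cons_le_of_current R δ I hI hc.1 hc.2 hf _) ?_
      dsimp only
      rw [hc.1]
      refine le_trans (mean_batchWeight_le I i j _ r d hz _) (le_of_eq ?_)
      unfold failPotential
      dsimp only
      rw [if_neg hf]
      rcases hcall : (stateAfter R δ h).call with _ | c
      · rw [batch_eq_nil_of_call_eq_none R δ h hcall]
        simp [hc.2]
      · have : c.2 = (i, j) := by simpa [currentCall, hcall] using hc.1
        simp [hc.2, this]
    · rw [mean_step_identifying R δ ε I hI]
      exact mean_le_const _ fun y =>
        failPotential_cons_le_of_not_current R δ I hI hc hf _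
  · rw [Agent.mean_step]
    have h1 : ∀ o, failPotential R δ I i j r d z (o :: h) = failPotential R δ I i j r d z h := by
      intro o
      have h2 : Fails R δ I i j r d z (o :: h) ↔ Fails R δ I i j r d z h :=
        ⟨fun h => h.resolve_right fun h => hI h.1, Or.inl⟩
      unfold failPotential
      dsimp only
      rw [stateAfter_cons_not_identifying R δ hI, if_neg (mt h2.1 hf), if_neg hf]
    simp only [h1, mean_const, le_refl]

/-- All trackers start at `1 ≤ r`, so the potential starts at the weight of the empty batch, which
is the right-hand side. -/
lemma mean_fails_le (i j : Fin K) (r : ℕ) (hr : 1 ≤ r) (d : Fin D) {z : ℝ} (hz : z ^ 2 = 1)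
    (T : ℕ) :
    mean ((fairEpsGreedy R δ ε).law I T) (fun h => ind (Fails R δ I i j r d z h)) ≤
      ENNReal.ofReal (Real.exp (-(batchSize (δ / D / K) r * width r ^ 2 / 2))) := by
  refine le_trans (mean_mono _ fun h => ?_) (le_trans (Agent.mean_law_le _ I
    (failPotential R δ I i j r d z) (mean_failPotential_le R δ I ε i j r d hz) T) (le_of_eq ?_))
  · by_cases hf : Fails R δ I i j r d z h
    · simp [failPotential, hf, ind_of]
    · simp [hf, ind_of_not]
  · have : ¬ Fails R δ I i j r d z [] := fun h => h
    simp [failPotential, this, stateAfter, State.init, batchWeight, excess, hr]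

end failure

/-! ### Batch sizes and the probability of a failure -/

/-- The confidence `δ_r` of round `r` of a comparison with confidence `δ'`. -/
def roundConf (δ' : ℝ) (r : ℕ) : ℝ := 6 * δ' / (Real.pi ^ 2 * (r : ℝ) ^ 2)

lemma roundConf_pos {δ' : ℝ} (hδ : 0 < δ') {r : ℕ} (hr : 1 ≤ r) : 0 < roundConf δ' r := by
  unfold roundConf
  have : (0 : ℝ) < r := by exact_mod_cast hr
  positivity

lemma nine_lt_pi_sq : (9 : ℝ) < Real.pi ^ 2 := by nlinarith [Real.pi_gt_three]

lemma pi_sq_lt_ten : Real.pi ^ 2 < (10 : ℝ) := by nlinarith [Real.pi_lt_d2, Real.pi_gt_three]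

lemma roundConf_le {δ' : ℝ} (hδ : 0 < δ') {r : ℕ} (hr : 1 ≤ r) : roundConf δ' r ≤ δ' := by
  unfold roundConf
  have h1 : (1 : ℝ) ≤ r := by exact_mod_cast hr
  have h2 : (1 : ℝ) ≤ (r : ℝ) ^ 2 := one_le_pow₀ h1
  rw [div_le_iff₀ (by positivity)]
  nlinarith [nine_lt_pi_sq, mul_le_mul nine_lt_pi_sq.le h2 zero_le_one (by positivity)]

lemma log_le_batchSize (δ' : ℝ) (r : ℕ) :
    8 * Real.log (4 / roundConf δ' r) ≤ batchSize δ' r * width r ^ 2 := by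
  have hw := width_pos r
  have h := Nat.le_ceil (8 * Real.log (4 / roundConf δ' r) / width r ^ 2)
  rwa [div_le_iff₀ (by positivity)] at h

/-- Half of `8 log (4 / δ_r)` is four logarithms, hence the fourth power. -/
lemma exp_neg_batchSize_le {δ' : ℝ} (hδ : 0 < δ') {r : ℕ} (hr : 1 ≤ r) :
    Real.exp (-(batchSize δ' r * width r ^ 2 / 2)) ≤ (roundConf δ' r / 4) ^ 4 := by
  have h := log_le_batchSize δ' r
  have hp := roundConf_pos hδ hr
  have h1 : Real.log (4 / roundConf δ' r) = - Real.log (roundConf δ' r / 4) := by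
    rw [← Real.log_inv, inv_div]
  calc Real.exp (-(batchSize δ' r * width r ^ 2 / 2))
      ≤ Real.exp (4 * Real.log (roundConf δ' r / 4)) := by
        apply Real.exp_le_exp.2
        rw [h1] at h
        linarith
    _ = (roundConf δ' r / 4) ^ 4 := by
        rw [show (4 : ℝ) * Real.log (roundConf δ' r / 4) = ((4 : ℕ) : ℝ) *
          Real.log (roundConf δ' r / 4) by norm_num, Real.exp_nat_mul, Real.exp_log (by positivity)]

/-- One factor `δ_r` is the summable share. The comparison confidence contains only one division by
`K` while there are `K ^ 2` ordered pairs; the three spare factors, each at most `1 / K`, supply the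
other, and `4 ^ 4` more than covers the two directions. -/
lemma roundConf_pow_le {D K : ℕ} (hD : 1 ≤ D) (hK : 1 ≤ K) {δ : ℝ} (hδ : 0 < δ) (hδ1 : δ ≤ 1)
    {r : ℕ} (hr : 1 ≤ r) :
    (roundConf (δ / D / K) r / 4) ^ 4 ≤
      δ / (2 * K ^ 2 * D) * (6 / Real.pi ^ 2 * (1 / (r : ℝ) ^ 2)) := by
  have hD' : (1 : ℝ) ≤ D := by exact_mod_cast hD
  have hK' : (1 : ℝ) ≤ K := by exact_mod_cast hK
  have hr' : (1 : ℝ) ≤ r := by exact_mod_cast hr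
  have hc : 0 < roundConf (δ / D / K) r := roundConf_pos (by positivity) hr
  have h1 : roundConf (δ / D / K) r ≤ 1 / K := by
    refine (roundConf_le (by positivity) hr).trans ?_
    gcongr
    exact (div_le_one (by positivity)).2 (hδ1.trans hD')
  have h2 : 1 / (K : ℝ) ≤ 1 := (div_le_one (by positivity)).2 hK'
  have h3 : δ / (2 * K ^ 2 * D) * (6 / Real.pi ^ 2 * (1 / (r : ℝ) ^ 2)) =
      roundConf (δ / D / K) r * (1 / K) / 2 := by
    unfold roundConf
    field_simp
  rw [h3]
  have h4 : roundConf (δ / D / K) r ^ 3 ≤ 1 / K := by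
    calc roundConf (δ / D / K) r ^ 3 ≤ (1 / (K : ℝ)) ^ 3 := by gcongr
      _ ≤ (1 / (K : ℝ)) ^ 1 := pow_le_pow_of_le_one (by positivity) h2 (by norm_num)
      _ = 1 / K := pow_one _
  have h5 := mul_le_mul_of_nonneg_left h4 hc.le
  have h6 : 0 ≤ roundConf (δ / D / K) r * (1 / K) := by positivity
  nlinarith

/-- The sign that belongs to a direction. -/
def sgn (b : Bool) : ℝ := if b then 1 else -1

lemma sgn_sq (b : Bool) : sgn b ^ 2 = 1 := by cases b <;> simp [sgn]

/-! ### Union bound over all completed batches -/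

section good

variable {D K : ℕ} (R : Choices D K) (δ : ℝ) (I : Instance D K)

/-- No completed batch was misleading for any user. -/
def Reliable (h : History D K) : Prop :=
  ∀ (i j : Fin K) (d : Fin D) (b : Bool) (r : ℕ), 1 ≤ r → ¬ Fails R δ I i j r d (sgn b) h

lemma Reliable.tail {o : Round D K} {h : History D K} (hr : Reliable R δ I (o :: h)) :
    Reliable R δ I h := fun i j d b r h1 h2 => hr i j d b r h1 (Or.inl h2)

variable [NeZero K] (ε : ℕ → ℝ)

/-- The identification phase is unreliable with probability at most `δ`. -/
lemma mean_not_reliable_le (hD : 1 ≤ D) (hδ : 0 < δ) (hδ1 : δ ≤ 1) (T : ℕ) :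
    mean ((fairEpsGreedy R δ ε).law I T) (fun h => ind (¬ Reliable R δ I h)) ≤
      ENNReal.ofReal δ := by
  have hK : 1 ≤ K := NeZero.one_le
  have hD' : (1 : ℝ) ≤ D := by exact_mod_cast hD
  have hK' : (1 : ℝ) ≤ K := by exact_mod_cast hK
  let F : Fin K × Fin K × Fin D × Bool → ℕ → History D K → ℝ≥0∞ := fun x r h =>
    ind (1 ≤ r ∧ Fails R δ I x.1 x.2.1 r x.2.2.1 (sgn x.2.2.2) h)
  -- There are `2 K ^ 2 D` index tuples `x`, and `6 / π ^ 2` normalizes `∑ 1 / r ^ 2`, so these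
  -- shares add up to `δ`.
  let g : ℕ → ℝ := fun r => δ / (2 * K ^ 2 * D) * (6 / Real.pi ^ 2 * (1 / (r : ℝ) ^ 2))
  have hF : ∀ x r, mean ((fairEpsGreedy R δ ε).law I T) (F x r) ≤ ENNReal.ofReal (g r) := by
    intro x r
    by_cases hr : 1 ≤ r
    · simp only [F, hr, true_and]
      refine (mean_fails_le R δ I ε _ _ r hr _ (sgn_sq _) T).trans (ENNReal.ofReal_le_ofReal ?_)
      exact (exp_neg_batchSize_le (by positivity) hr).trans (roundConf_pow_le hD hK hδ hδ1 hr)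
    · simp [F, hr, mean_const, ind_of_not]
  have hg : HasSum g (δ / (2 * K ^ 2 * D)) := by
    have h := (hasSum_zeta_two.mul_left (6 / Real.pi ^ 2)).mul_left (δ / (2 * K ^ 2 * D))
    have h1 : 6 / Real.pi ^ 2 * (Real.pi ^ 2 / 6) = 1 := by
      have := Real.pi_pos
      field_simp
    rw [h1, mul_one] at h
    exact h
  calc mean ((fairEpsGreedy R δ ε).law I T) (fun h => ind (¬ Reliable R δ I h))
      ≤ mean ((fairEpsGreedy R δ ε).law I T) (fun h => ∑ x, ∑' r, F x r h) := by
        refine mean_mono _ fun h => ?_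
        by_cases hR : Reliable R δ I h
        · simp [ind_of_not, hR]
        · rw [ind_of hR]
          unfold Reliable at hR
          push Not at hR
          obtain ⟨i, j, d, b, r, hr, hf⟩ := hR
          calc (1 : ℝ≥0∞) = F (i, j, d, b) r h := by simp [F, hr, hf, ind_of]
            _ ≤ ∑' r, F (i, j, d, b) r h := ENNReal.le_tsum r
            _ ≤ _ := Finset.single_le_sum (f := fun x => ∑' r, F x r h)
              (fun _ _ => zero_le) (Finset.mem_univ (i, j, d, b))
    _ = ∑ x, ∑' r, mean ((fairEpsGreedy R δ ε).law I T) (F x r) := by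
        rw [mean_sum]
        exact Finset.sum_congr rfl fun x _ => mean_tsum _ _
    _ ≤ ∑ x : Fin K × Fin K × Fin D × Bool, ∑' r, ENNReal.ofReal (g r) :=
        Finset.sum_le_sum fun x _ => ENNReal.tsum_le_tsum fun r => hF x r
    _ = ∑ x : Fin K × Fin K × Fin D × Bool, ENNReal.ofReal (δ / (2 * K ^ 2 * D)) := by
        rw [← ENNReal.ofReal_tsum_of_nonneg (fun r => by positivity) hg.summable, hg.tsum_eq]
    _ = ENNReal.ofReal δ := by
        rw [Finset.sum_const, nsmul_eq_mul, ← ENNReal.ofReal_natCast, ← ENNReal.ofReal_mul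
          (by positivity)]
        congr 1
        simp only [Finset.card_univ, Fintype.card_prod, Fintype.card_fin, Fintype.card_bool]
        push_cast
        field_simp

end good

/-! ### The identification phase on reliable histories -/

lemma batchSize_pos {δ' : ℝ} (hδ : 0 < δ') (hδ1 : δ' ≤ 1) {r : ℕ} (hr : 1 ≤ r) :
    0 < batchSize δ' r := by
  have h1 := roundConf_pos hδ hr
  have h2 := (roundConf_le hδ hr).trans hδ1
  have hw := width_pos r
  refine Nat.ceil_pos.2 ?_
  have h3 : 0 < Real.log (4 / roundConf δ' r) := by
    apply Real.log_pos
    rw [lt_div_iff₀ h1]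
    linarith
  unfold roundConf at h3
  positivity

/-- The number of duels in the rounds `1, …, r - 1` of a comparison. -/
def duelBudget (δ' : ℝ) (r : ℕ) : ℕ := ∑ k ∈ Finset.Ico 1 r, batchSize δ' k

lemma duelBudget_succ (δ' : ℝ) {r : ℕ} (hr : 1 ≤ r) :
    duelBudget δ' (r + 1) = duelBudget δ' r + batchSize δ' r :=
  Finset.sum_Ico_succ_top hr _

lemma duelBudget_mono (δ' : ℝ) : Monotone (duelBudget δ') := fun _ _ h =>
  Finset.sum_le_sum_of_subset (Finset.Ico_subset_Ico_right h)

/-! ### Effect of an accurate batch on a candidate set -/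

section eliminate

variable {D K : ℕ} {I : Instance D K} {i j : Fin K} {d : Fin D}
  {r : ℕ} {ys : List (Fin D → Bool)} {S : Finset (Fin K)}

lemma eliminate_subset (h : ℝ) : eliminate h i j ys d S ⊆ S := by
  unfold eliminate
  dsimp only
  split_ifs
  · exact Finset.erase_subset _ _
  · exact Finset.erase_subset _ _
  · exact subset_rfl

lemma abs_freq_sub_le (hlen : 0 < ys.length)
    (hex : |excess (I.pref d i j) d ys| ≤ width r / 2 * ys.length) :
    |((ys.countP fun y => y d : ℕ) : ℝ) / ys.length - I.pref d i j| ≤ width r / 2 := by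
  have hl : (0 : ℝ) < ys.length := by exact_mod_cast hlen
  have : ((ys.countP fun y => y d : ℕ) : ℝ) / ys.length - I.pref d i j =
      excess (I.pref d i j) d ys / ys.length := by
    unfold excess
    field_simp
  rw [this, abs_div, abs_of_pos hl, div_le_iff₀ hl]
  exact hex

/-- An elimination requires a frequency more than `h / 2` away from `1 / 2`. As the frequency is
within `h / 2` of the truth, the erased arm really is the weaker one of the two. -/
lemma winner_mem_eliminate {a : Fin K} (ha : I.IsCondorcetWinner d a) (hij : i ≠ j)
    (haS : a ∈ S) (hlen : 0 < ys.length)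
    (hex : |excess (I.pref d i j) d ys| ≤ width r / 2 * ys.length) :
    a ∈ eliminate (width r) i j ys d S := by
  have hf := abs_le.1 (abs_freq_sub_le hlen hex)
  unfold eliminate
  dsimp only
  split_ifs with h1 h2
  · refine Finset.mem_erase.2 ⟨?_, haS⟩
    rintro rfl
    have h3 := ha i hij
    have h4 := I.pref_add d a i
    have h5 := h1.2.2
    rw [abs_of_pos (by linarith)] at h5
    linarith [hf.2]
  · refine Finset.mem_erase.2 ⟨?_, haS⟩
    rintro rfl
    have h3 := ha j hij.symm
    have h5 := h1.2.2
    rw [abs_of_nonpos (by linarith)] at h5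
    linarith [hf.1]
  · exact haS

/-- If the gap exceeds `h`, a frequency within `h / 2` of the truth is still more than `h / 2` away
from `1 / 2`, so the test cannot be inconclusive. -/
lemma not_both_mem_eliminate (hgap : width r < |1 / 2 - I.pref d i j|) (hlen : 0 < ys.length)
    (hex : |excess (I.pref d i j) d ys| ≤ width r / 2 * ys.length) :
    ¬ (i ∈ eliminate (width r) i j ys d S ∧ j ∈ eliminate (width r) i j ys d S) := by
  rintro ⟨hi, hj⟩
  have hf := abs_freq_sub_le hlen hex
  have hiS := eliminate_subset _ hi
  have hjS := eliminate_subset _ hj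
  unfold eliminate at hi hj
  dsimp only at hi hj
  split_ifs at hi hj with h1 h2
  · exact (Finset.mem_erase.1 hj).1 rfl
  · exact (Finset.mem_erase.1 hi).1 rfl
  · apply h1
    refine ⟨hiS, hjS, ?_⟩
    have h3 := abs_sub_le (1 / 2) (((ys.countP fun y => y d : ℕ) : ℝ) / ys.length) (I.pref d i j)
    rw [abs_sub_comm (1 / 2) (((ys.countP fun y => y d : ℕ) : ℝ) / ys.length)] at h3
    linarith

end eliminate

/-! ### Invariants and length of the identification phase -/

section invariant

variable {D K : ℕ} (R : Choices D K) (δ : ℝ) (I : Instance D K) (w : Fin D → Fin K) (rs : ℕ)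

/-- The number of eliminations so far. -/
def State.eliminated (σ : State D K) : ℕ := ∑ d, (K - (σ.cand d).card)

/-- The number of duels of the pair of the comparison in progress. -/
def State.callDuels (δ' : ℝ) (σ : State D K) : ℕ :=
  σ.call.elim 0 fun c => duelBudget δ' (σ.tracker s(c.2.1, c.2.2)) + σ.batch.length

/-- The invariants of the identification phase, when all comparisons stop in round `rs`. -/
structure State.Sound (δ' : ℝ) (σ : State D K) : Prop where
  winner_mem : ∀ d, w d ∈ σ.cand d
  tracker_pos : ∀ p, 1 ≤ σ.tracker p
  of_tracker_gt : ∀ i j, i ≠ j → rs < σ.tracker s(i, j) → ∀ d, ¬ (i ∈ σ.cand d ∧ j ∈ σ.cand d)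
  call_mem : ∀ c, σ.call = some c → c.2.1 ∈ σ.cand c.1 ∧ c.2.2 ∈ σ.cand c.1 ∧ c.2.1 ≠ c.2.2
  batch_lt : ∀ c, σ.call = some c → σ.batch.length < batchSize δ' (σ.tracker s(c.2.1, c.2.2))

variable {R δ I w rs}

lemma currentCall_spec {h : History D K} {σ : State D K} {δ' : ℝ} (hσ : σ.Sound w rs δ')
    (hI : σ.Identifying) :
    (currentCall R h σ).2.1 ∈ σ.cand (currentCall R h σ).1 ∧
      (currentCall R h σ).2.2 ∈ σ.cand (currentCall R h σ).1 ∧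
      (currentCall R h σ).2.1 ≠ (currentCall R h σ).2.2 := by
  unfold currentCall
  rcases hc : σ.call with _ | c
  · simpa using R.pick_spec h σ.cand hI
  · simpa using hσ.call_mem c hc

/-- The calling user still has both arms, which the invariant excludes for trackers beyond `rs`. -/
lemma tracker_currentCall_le {h : History D K} {σ : State D K} {δ' : ℝ} (hσ : σ.Sound w rs δ')
    (hI : σ.Identifying) :
    σ.tracker s((currentCall R h σ).2.1, (currentCall R h σ).2.2) ≤ rs := by
  by_contra! hlt
  have h1 := currentCall_spec (R := R) (h := h) hσ hI
  exact hσ.of_tracker_gt _ _ h1.2.2 hlt _ ⟨h1.1, h1.2.1⟩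

lemma Reliable.abs_excess_le {o : Round D K} {h : History D K} (hr : Reliable R δ I (o :: h))
    (hI : (stateAfter R δ h).Identifying)
    {i j : Fin K} {r : ℕ} (hc : (currentCall R h (stateAfter R δ h)).2 = (i, j)) (hr1 : 1 ≤ r)
    (ht : (stateAfter R δ h).tracker s(i, j) = r)
    (hb : batchSize (δ / D / K) r ≤ (o.y :: (stateAfter R δ h).batch).length) (d : Fin D) :
    |excess (I.pref d i j) d (o.y :: (stateAfter R δ h).batch)| ≤
      width r / 2 * (o.y :: (stateAfter R δ h).batch).length := by
  have key : ∀ b : Bool, sgn b * excess (I.pref d i j) d (o.y :: (stateAfter R δ h).batch) ≤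
      width r / 2 * (o.y :: (stateAfter R δ h).batch).length := by
    intro b
    by_contra! hlt
    exact hr i j d b r hr1 (Or.inr ⟨hI, hc, ht, hb, hlt⟩)
  have h1 := key true
  have h2 := key false
  simp only [sgn, if_true, Bool.false_eq_true, if_false, one_mul, neg_mul] at h1 h2
  exact abs_le.2 ⟨by linarith, h1⟩

lemma identify_of_lt {δ' : ℝ} {h : History D K} {σ : State D K} {y : Fin D → Bool}
    (hlt : (y :: σ.batch).length < batchSize δ'
      (σ.tracker s((currentCall R h σ).2.1, (currentCall R h σ).2.2))) :
    identify R δ' h σ y = { σ with call := some (currentCall R h σ), batch := y :: σ.batch } := by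
  simp only [identify, hlt, if_true]

/-- The candidate sets after a completed round of the current comparison. -/
def newCand (R : Choices D K) (h : History D K) (σ : State D K) (y : Fin D → Bool) (d : Fin D) :
    Finset (Fin K) :=
  eliminate (width (σ.tracker s((currentCall R h σ).2.1, (currentCall R h σ).2.2)))
    (currentCall R h σ).2.1 (currentCall R h σ).2.2 (y :: σ.batch) d (σ.cand d)

open Classical in
lemma identify_of_not_lt {δ' : ℝ} {h : History D K} {σ : State D K} {y : Fin D → Bool}
    (hlt : ¬ (y :: σ.batch).length < batchSize δ'
      (σ.tracker s((currentCall R h σ).2.1, (currentCall R h σ).2.2))) :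
    identify R δ' h σ y =
      { cand := newCand R h σ y
        tracker := Function.update σ.tracker s((currentCall R h σ).2.1, (currentCall R h σ).2.2)
          (σ.tracker s((currentCall R h σ).2.1, (currentCall R h σ).2.2) + 1)
        call := if (currentCall R h σ).2.1 ∈ newCand R h σ y (currentCall R h σ).1 ∧
            (currentCall R h σ).2.2 ∈ newCand R h σ y (currentCall R h σ).1
          then some (currentCall R h σ) else none
        batch := []
        main := σ.main } := by
  simp only [identify, hlt, if_false]
  rfl

lemma batch_length_lt {δ' : ℝ} (hδ : 0 < δ') (hδ1 : δ' ≤ 1) {h : History D K}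
    (hσ : (stateAfter R δ h).Sound w rs δ') :
    (stateAfter R δ h).batch.length < batchSize δ' ((stateAfter R δ h).tracker
      s((currentCall R h (stateAfter R δ h)).2.1, (currentCall R h (stateAfter R δ h)).2.2)) := by
  rcases hc : (stateAfter R δ h).call with _ | c
  · rw [batch_eq_nil_of_call_eq_none R δ h hc]
    exact batchSize_pos hδ hδ1 (hσ.tracker_pos _)
  · have : currentCall R h (stateAfter R δ h) = c := by simp [currentCall, hc]
    rw [this]
    exact hσ.batch_lt c hc

/-- Candidate sets and trackers change only when a batch is completed, and on a reliable history
that batch is accurate for every user, not only for the caller. Accuracy protects the winners, and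
at width below the gap it separates the pair for everyone. -/
lemma Reliable.sound (hw : ∀ d, I.IsCondorcetWinner d (w d))
    (hgap : ∀ d i j, i ≠ j → width rs < |1 / 2 - I.pref d i j|) (hrs : 1 ≤ rs)
    (hδ : 0 < δ / D / K) (hδ1 : δ / D / K ≤ 1)
    {h : History D K} (hr : Reliable R δ I h) :
    (stateAfter R δ h).Sound w rs (δ / D / K) := by
  induction h with
  | nil =>
    refine ⟨fun d => Finset.mem_univ _, fun p => le_refl _, fun i j _ h => ?_, ?_, ?_⟩
    · exact absurd h (not_lt.2 hrs)
    · intro c hc; simp [stateAfter, State.init] at hc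
    · intro c hc; simp [stateAfter, State.init] at hc
  | cons o h ih =>
    have hS := ih (Reliable.tail R δ I hr)
    by_cases hI : (stateAfter R δ h).Identifying
    swap
    · rw [stateAfter_cons_not_identifying R δ hI]
      exact ⟨hS.winner_mem, hS.tracker_pos, hS.of_tracker_gt, hS.call_mem, hS.batch_lt⟩
    rw [stateAfter_cons_identifying R δ hI]
    have hspec := currentCall_spec (R := R) (h := h) hS hI
    have htr := tracker_currentCall_le (R := R) (h := h) hS hI
    by_cases hlt : (o.y :: (stateAfter R δ h).batch).length < batchSize (δ / D / K)
      ((stateAfter R δ h).tracker s((currentCall R h (stateAfter R δ h)).2.1,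
        (currentCall R h (stateAfter R δ h)).2.2))
    · rw [identify_of_lt hlt]
      refine ⟨hS.winner_mem, hS.tracker_pos, hS.of_tracker_gt, ?_, ?_⟩
      · intro c hc
        obtain rfl := Option.some.inj hc
        exact hspec
      · intro c hc
        obtain rfl := Option.some.inj hc
        exact hlt
    · rw [identify_of_not_lt hlt]
      have hex := hr.abs_excess_le hI rfl (hS.tracker_pos _) rfl (not_lt.1 hlt)
      have hlen : 0 < (o.y :: (stateAfter R δ h).batch).length := Nat.succ_pos _
      refine ⟨?_, ?_, ?_, ?_, ?_⟩
      · exact fun d => winner_mem_eliminate (hw d) hspec.2.2 (hS.winner_mem d) hlen (hex d)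
      · intro p
        dsimp only
        rw [Function.update_apply]
        split_ifs
        · exact Nat.succ_pos _
        · exact hS.tracker_pos p
      · intro i j hij hgt d hmem
        dsimp only at hgt hmem
        rw [Function.update_apply] at hgt
        split_ifs at hgt with hp
        -- The current tracker was at most `rs` and has just exceeded it, so the completed batch had
        -- exactly the width `width rs`, which is below every gap.
        · have hteq : (stateAfter R δ h).tracker s((currentCall R h (stateAfter R δ h)).2.1,
              (currentCall R h (stateAfter R δ h)).2.2) = rs := by omega
          have hnb := not_both_mem_eliminate (S := (stateAfter R δ h).cand d)
            (by rw [hteq]; exact hgap d _ _ hspec.2.2) hlen (hex d)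
          rcases Sym2.eq_iff.1 hp with ⟨h1, h2⟩ | ⟨h1, h2⟩
          · rw [h1, h2] at hmem
            exact hnb hmem
          · rw [h1, h2] at hmem
            exact hnb hmem.symm
        · exact hS.of_tracker_gt i j hij hgt d
            ⟨eliminate_subset _ hmem.1, eliminate_subset _ hmem.2⟩
      · intro c hc
        dsimp only at hc ⊢
        split_ifs at hc with hmem
        obtain rfl := Option.some.inj hc
        exact ⟨hmem.1, hmem.2, hspec.2.2⟩
      · intro c hc
        dsimp only at hc ⊢
        exact batchSize_pos hδ hδ1 (by
          rw [Function.update_apply]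
          split_ifs
          · exact Nat.succ_pos _
          · exact hS.tracker_pos _)

lemma State.eliminated_le_of_subset {σ τ : State D K} (hsub : ∀ d, τ.cand d ⊆ σ.cand d) :
    σ.eliminated ≤ τ.eliminated :=
  Finset.sum_le_sum fun d _ => Nat.sub_le_sub_left (Finset.card_le_card (hsub d)) _

lemma State.eliminated_lt_of_ssubset {σ τ : State D K} (hsub : ∀ d, τ.cand d ⊆ σ.cand d)
    {d : Fin D} (hd : τ.cand d ⊂ σ.cand d) : σ.eliminated < τ.eliminated := by
  refine Finset.sum_lt_sum (fun d _ => Nat.sub_le_sub_left (Finset.card_le_card (hsub d)) _)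
    ⟨d, Finset.mem_univ d, ?_⟩
  have h1 := Finset.card_lt_card hd
  have h2 := (Finset.card_le_univ (σ.cand d)).trans_eq (Fintype.card_fin K)
  omega

/-- On a reliable history, the number of duels is controlled by the number of eliminations. -/
lemma Reliable.length_le (hw : ∀ d, I.IsCondorcetWinner d (w d))
    (hgap : ∀ d i j, i ≠ j → width rs < |1 / 2 - I.pref d i j|) (hrs : 1 ≤ rs)
    (hδ : 0 < δ / D / K) (hδ1 : δ / D / K ≤ 1)
    {h : History D K} (hr : Reliable R δ I h) :
    h.length ≤ duelBudget (δ / D / K) (rs + 1) * (stateAfter R δ h).eliminated +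
      (stateAfter R δ h).callDuels (δ / D / K) + (stateAfter R δ h).main.length := by
  induction h with
  | nil => simp
  | cons o h ih =>
    have hr' := Reliable.tail R δ I hr
    have hS := hr'.sound hw hgap hrs hδ hδ1
    have ih := ih hr'
    by_cases hI : (stateAfter R δ h).Identifying
    swap
    · rw [stateAfter_cons_not_identifying R δ hI]
      simp only [List.length_cons]
      unfold State.eliminated State.callDuels at *
      dsimp only at *
      omega
    rw [stateAfter_cons_identifying R δ hI]
    have hspec := currentCall_spec (R := R) (h := h) hS hI
    have htr := tracker_currentCall_le (R := R) (h := h) hS hI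
    have hbl := batch_length_lt hδ hδ1 hS
    -- A comparison resumes at the round where earlier comparisons of the same pair stopped.
    -- Charging it with all rounds of the pair since the first overcounts, which is harmless for an
    -- upper bound.
    have hcd : (stateAfter R δ h).callDuels (δ / D / K) ≤
        duelBudget (δ / D / K) ((stateAfter R δ h).tracker
          s((currentCall R h (stateAfter R δ h)).2.1, (currentCall R h (stateAfter R δ h)).2.2)) +
        (stateAfter R δ h).batch.length := by
      unfold State.callDuels currentCall
      rcases hc : (stateAfter R δ h).call with _ | c <;> simp
    by_cases hlt : (o.y :: (stateAfter R δ h).batch).length < batchSize (δ / D / K)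
      ((stateAfter R δ h).tracker s((currentCall R h (stateAfter R δ h)).2.1,
        (currentCall R h (stateAfter R δ h)).2.2))
    · rw [identify_of_lt hlt]
      have h1 : ({ stateAfter R δ h with
          call := some (currentCall R h (stateAfter R δ h)),
          batch := o.y :: (stateAfter R δ h).batch } : State D K).eliminated =
          (stateAfter R δ h).eliminated := rfl
      rw [h1]
      simp only [State.callDuels, Option.elim_some, List.length_cons]
      omega
    · have hsucc := duelBudget_succ (δ / D / K) (hS.tracker_pos
        s((currentCall R h (stateAfter R δ h)).2.1, (currentCall R h (stateAfter R δ h)).2.2))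
      have hsub : ∀ d, newCand R h (stateAfter R δ h) o.y d ⊆ (stateAfter R δ h).cand d :=
        fun d => eliminate_subset _
      rw [identify_of_not_lt hlt]
      simp only [List.length_cons]
      by_cases hmem : (currentCall R h (stateAfter R δ h)).2.1 ∈ newCand R h (stateAfter R δ h) o.y
          (currentCall R h (stateAfter R δ h)).1 ∧ (currentCall R h (stateAfter R δ h)).2.2 ∈
          newCand R h (stateAfter R δ h) o.y (currentCall R h (stateAfter R δ h)).1
      -- The comparison goes on: the completed batch moves from `batch` into the budget of the next
      -- round.
      · simp only [hmem, and_self, if_true]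
        refine le_trans ?_ (add_le_add_left (add_le_add_left (Nat.mul_le_mul_left _
          (State.eliminated_le_of_subset (σ := stateAfter R δ h) ?_)) _) _)
        · simp only [State.callDuels, Option.elim_some, Function.update_self, List.length_nil]
          omega
        · exact hsub
      -- The comparison ends because the caller lost an arm. This new elimination pays for the
      -- entire comparison.
      · simp only [hmem, if_false]
        have hss : newCand R h (stateAfter R δ h) o.y (currentCall R h (stateAfter R δ h)).1 ⊂
            (stateAfter R δ h).cand (currentCall R h (stateAfter R δ h)).1 := by
          refine (hsub _).ssubset_of_ne fun heq => hmem ?_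
          rw [heq]
          exact ⟨hspec.1, hspec.2.1⟩
        refine le_trans ?_ (add_le_add_left (add_le_add_left (Nat.mul_le_mul_left _
          (Nat.succ_le_of_lt (State.eliminated_lt_of_ssubset (σ := stateAfter R δ h)
            ?_ (d := (currentCall R h (stateAfter R δ h)).1) ?_))) _) _)
        · have hM := duelBudget_mono (δ / D / K) (Nat.succ_le_succ htr)
          simp only [Nat.succ_eq_add_one] at hM
          simp only [State.callDuels, Option.elim_none, Nat.succ_eq_add_one, mul_add, mul_one]
          omega
        · exact hsub
        · exact hss

/-- The running comparison costs less than one further budget, and fewer than `D K` eliminations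
have occurred so far, so together at most `D K` budgets are charged. -/
lemma Reliable.length_lt_of_identifying (hw : ∀ d, I.IsCondorcetWinner d (w d))
    (hgap : ∀ d i j, i ≠ j → width rs < |1 / 2 - I.pref d i j|) (hrs : 1 ≤ rs)
    (hδ : 0 < δ / D / K) (hδ1 : δ / D / K ≤ 1)
    {h : History D K} (hr : Reliable R δ I h) (hI : (stateAfter R δ h).Identifying) :
    h.length < duelBudget (δ / D / K) (rs + 1) * (D * K) := by
  have hS := hr.sound hw hgap hrs hδ hδ1
  have h1 := hr.length_le hw hgap hrs hδ hδ1
  rw [main_eq_nil_of_identifying R δ h hI] at h1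
  have htr := tracker_currentCall_le (R := R) (h := h) hS hI
  have hbl := batch_length_lt hδ hδ1 hS
  have hsucc := duelBudget_succ (δ / D / K) (hS.tracker_pos
    s((currentCall R h (stateAfter R δ h)).2.1, (currentCall R h (stateAfter R δ h)).2.2))
  have hM := duelBudget_mono (δ / D / K) (Nat.succ_le_succ htr)
  simp only [Nat.succ_eq_add_one] at hM
  have hcd : (stateAfter R δ h).callDuels (δ / D / K) ≤
      duelBudget (δ / D / K) ((stateAfter R δ h).tracker
        s((currentCall R h (stateAfter R δ h)).2.1, (currentCall R h (stateAfter R δ h)).2.2)) +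
      (stateAfter R δ h).batch.length := by
    unfold State.callDuels currentCall
    rcases hc : (stateAfter R δ h).call with _ | c <;> simp
  -- Strict, since some user still has candidates left.
  have hel : (stateAfter R δ h).eliminated + 1 ≤ D * K := by
    have hlt : (stateAfter R δ h).eliminated < ∑ _d : Fin D, K := by
      have hle : ∀ d, K - ((stateAfter R δ h).cand d).card ≤ K := fun d => Nat.sub_le _ _
      obtain ⟨d, hd⟩ := hI
      refine Finset.sum_lt_sum (fun d _ => hle d) ⟨d, Finset.mem_univ d, ?_⟩
      have hK : 0 < K := (w d).pos
      omega
    simpa using hlt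
  have h2 := Nat.mul_le_mul_left (duelBudget (δ / D / K) (rs + 1)) hel
  rw [mul_add, mul_one] at h2
  simp only [List.length_nil] at h1
  omega

lemma Reliable.winner_eq [NeZero K] (hw : ∀ d, I.IsCondorcetWinner d (w d))
    (hgap : ∀ d i j, i ≠ j → width rs < |1 / 2 - I.pref d i j|) (hrs : 1 ≤ rs)
    (hδ : 0 < δ / D / K) (hδ1 : δ / D / K ≤ 1)
    {h : History D K} (hr : Reliable R δ I h) (hI : ¬ (stateAfter R δ h).Identifying) (d : Fin D) :
    (stateAfter R δ h).winner d = w d := by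
  have hmem := (hr.sound hw hgap hrs hδ hδ1).winner_mem d
  have hcard : ((stateAfter R δ h).cand d).card ≤ 1 := by
    by_contra! hlt
    exact hI ⟨d, hlt⟩
  have hne : ((stateAfter R δ h).cand d).Nonempty := ⟨_, hmem⟩
  unfold State.winner
  rw [dif_pos hne]
  exact Finset.card_le_one.1 hcard _ (Finset.min'_mem _ _) _ hmem

end invariant

/-! ### Concentration in the main loop -/

section main

variable {D K : ℕ} (R : Choices D K) (δ : ℝ)

lemma main_cons_identifying {h : History D K} (hI : (stateAfter R δ h).Identifying)
    (o : Round D K) : (stateAfter R δ (o :: h)).main = (stateAfter R δ h).main := by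
  rw [stateAfter_cons_identifying R δ hI]
  unfold identify
  dsimp only
  split_ifs <;> rfl

lemma main_cons_not_identifying {h : History D K} (hI : ¬ (stateAfter R δ h).Identifying)
    (o : Round D K) : (stateAfter R δ (o :: h)).main = o :: (stateAfter R δ h).main := by
  rw [stateAfter_cons_not_identifying R δ hI]

variable [NeZero K] (ε : ℕ → ℝ) (I : Instance D K)

/-- A supermartingale of the main loop, evaluated in round `n` of the main loop. -/
lemma sum_mean_main_le (W : List (Round D K) → ℝ≥0∞)
    (hW : ∀ h, ¬ (stateAfter R δ h).Identifying →
      mean ((fairEpsGreedy R δ ε).step I h) (fun h' => W (stateAfter R δ h').main) ≤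
        W (stateAfter R δ h).main) (n T : ℕ) :
    ∑ t ∈ Finset.range T, mean ((fairEpsGreedy R δ ε).law I t) (fun h =>
      ind (¬ (stateAfter R δ h).Identifying ∧ (stateAfter R δ h).main.length = n) *
        W (stateAfter R δ h).main) ≤ W [] := by
  -- The potential is `W` killed once the main loop is longer than `n`. It is constant during
  -- identification, a supermartingale up to length `n`, and it is paid out as cost in the single
  -- round that starts at length `n`.
  refine le_trans le_self_add (le_trans (Agent.sum_mean_law_le _ I (fun h =>
    ind ((stateAfter R δ h).main.length ≤ n) * W (stateAfter R δ h).main) _ ?_ T) ?_)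
  · intro h
    by_cases hI : (stateAfter R δ h).Identifying
    · rw [mean_step_identifying R δ ε I hI]
      have h1 : ¬ (¬ (stateAfter R δ h).Identifying ∧ (stateAfter R δ h).main.length = n) :=
        fun hc => hc.1 hI
      simp only [main_cons_identifying R δ hI, mean_const, ind_of_not h1, zero_mul, add_zero,
        le_refl]
    · rcases lt_trichotomy (stateAfter R δ h).main.length n with hn | hn | hn
      · have h1 : ¬ (¬ (stateAfter R δ h).Identifying ∧ (stateAfter R δ h).main.length = n) :=
          fun hc => hn.ne hc.2
        rw [ind_of_not h1, ind_of hn.le, zero_mul, add_zero, one_mul]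
        exact le_trans (mean_mono _ fun h' => mul_le_of_le_one_left' (ind_le_one _)) (hW h hI)
      · rw [ind_of ⟨hI, hn⟩, ind_of hn.le, Agent.mean_step]
        have h1 : ∀ o : Round D K, ¬ (stateAfter R δ (o :: h)).main.length ≤ n := by
          intro o
          rw [main_cons_not_identifying R δ hI, List.length_cons]
          omega
        simp [h1, ind_of_not, mean_const]
      · rw [Agent.mean_step]
        have h1 : ∀ o : Round D K, ¬ (stateAfter R δ (o :: h)).main.length ≤ n := by
          intro o
          rw [main_cons_not_identifying R δ hI, List.length_cons]
          omega
        have h2 : ¬ (¬ (stateAfter R δ h).Identifying ∧ (stateAfter R δ h).main.length = n) :=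
          fun hc => hn.ne' hc.2
        simp [ind_of_not, h1, h2, mean_const]
  · simp [stateAfter, State.init, ind_of]

/-- A history passes through each main-loop index at most once; this turns sums over the absolute
time `t` into one term per main-loop round. -/
lemma sum_mean_main_length_le (n T : ℕ) :
    ∑ t ∈ Finset.range T, mean ((fairEpsGreedy R δ ε).law I t) (fun h =>
      ind (¬ (stateAfter R δ h).Identifying ∧ (stateAfter R δ h).main.length = n)) ≤ 1 := by
  simpa using sum_mean_main_le R δ ε I (fun _ => 1) (fun h _ => by rw [mean_const]) n T

/-- Markov's inequality for `sum_mean_main_le`. -/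
lemma sum_mean_main_event_le (W : List (Round D K) → ℝ)
    (hW : ∀ h, ¬ (stateAfter R δ h).Identifying →
      mean ((fairEpsGreedy R δ ε).step I h)
          (fun h' => ENNReal.ofReal (W (stateAfter R δ h').main)) ≤
        ENNReal.ofReal (W (stateAfter R δ h).main)) (n T : ℕ) (hW0 : W [] = 1)
    {c : ℝ} (hc : 0 < c) (P : List (Round D K) → Prop)
    (hP : ∀ l, l.length = n → P l → c⁻¹ ≤ W l) :
    ∑ t ∈ Finset.range T, mean ((fairEpsGreedy R δ ε).law I t) (fun h =>
      ind (¬ (stateAfter R δ h).Identifying ∧ (stateAfter R δ h).main.length = n ∧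
        P (stateAfter R δ h).main)) ≤ ENNReal.ofReal c := by
  have h1 := sum_mean_main_le R δ ε I (fun l => ENNReal.ofReal (W l)) hW n T
  rw [hW0, ENNReal.ofReal_one] at h1
  calc _ ≤ ∑ t ∈ Finset.range T, mean ((fairEpsGreedy R δ ε).law I t) (fun h =>
        ENNReal.ofReal c * (ind (¬ (stateAfter R δ h).Identifying ∧
          (stateAfter R δ h).main.length = n) *
          ENNReal.ofReal (W (stateAfter R δ h).main))) := by
        refine Finset.sum_le_sum fun t _ => mean_mono _ fun h => ?_
        by_cases h2 : ¬ (stateAfter R δ h).Identifying ∧ (stateAfter R δ h).main.length = n ∧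
          P (stateAfter R δ h).main
        · rw [ind_of h2, ind_of ⟨h2.1, h2.2.1⟩, one_mul, ← ENNReal.ofReal_mul hc.le,
            ENNReal.one_le_ofReal]
          have := mul_le_mul_of_nonneg_left (hP _ h2.2.1 h2.2.2) hc.le
          rwa [mul_inv_cancel₀ hc.ne'] at this
        · rw [ind_of_not h2]
          exact zero_le
    _ ≤ ENNReal.ofReal c * 1 := by
        simp only [mean_mul_left, ← Finset.mul_sum]
        exact mul_le_mul_right h1 _
    _ = ENNReal.ofReal c := mul_one _

/-! ### The number of explorations -/

lemma uniformLE_true {p : ℝ} : uniformLE p true = ENNReal.ofReal (min 1 p) := by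
  simp [uniformLE, ENNReal.ofReal_min]

lemma uniformLE_false {p : ℝ} (hp : 0 ≤ p) :
    uniformLE p false = ENNReal.ofReal (1 - min 1 p) := by
  rw [ENNReal.ofReal_sub _ (by positivity), ENNReal.ofReal_one]
  simp [uniformLE, ENNReal.ofReal_min]

/-- The number of explorations. -/
def explorations (l : List (Round D K)) : ℕ := l.countP fun o => o.coin

/-- The exponential weight of the number of explorations. -/
def exploreWeight (l : List (Round D K)) : ℝ :=
  Real.exp (-(explorations l : ℝ) +
    (1 - Real.exp (-1)) * ∑ k ∈ Finset.range l.length, min 1 (ε (k + 1)))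

/-- A coin of bias `q` has `E exp (-coin) = 1 - (1 - e⁻¹) q`, which is at most `exp (-(1 - e⁻¹) q)`.
The bias depends on the history only through the length of the main loop. -/
lemma mean_exploreWeight_le (hε : ∀ n, 1 ≤ n → 0 ≤ ε n) {h : History D K}
    (hI : ¬ (stateAfter R δ h).Identifying) :
    mean ((fairEpsGreedy R δ ε).step I h)
      (fun h' => ENNReal.ofReal (exploreWeight ε (stateAfter R δ h').main)) ≤
        ENNReal.ofReal (exploreWeight ε (stateAfter R δ h).main) := by
  rw [Agent.mean_step]
  simp only [main_cons_not_identifying R δ hI]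
  generalize hl : (stateAfter R δ h).main = l
  have hcoin : (fairEpsGreedy R δ ε).coin h = uniformLE (ε (l.length + 1)) := by
    simp [fairEpsGreedy, hI, hl]
  have hε' := hε (l.length + 1) (Nat.succ_pos _)
  set q := min 1 (ε (l.length + 1)) with hq
  have hq0 : 0 ≤ q := le_min zero_le_one hε'
  have hq1 : q ≤ 1 := min_le_left _ _
  have hw : ∀ (c : Bool) (a b : Fin K) (y : Fin D → Bool),
      exploreWeight ε ((⟨c, a, b, y⟩ : Round D K) :: l) = exploreWeight ε l *
        (Real.exp (if c then -1 else 0) * Real.exp ((1 - Real.exp (-1)) * q)) := by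
    intro c a b y
    unfold exploreWeight explorations
    rw [← Real.exp_add, ← Real.exp_add, List.countP_cons, List.length_cons,
      Finset.sum_range_succ, ← hq]
    congr 1
    cases c <;> simp <;> ring
  simp only [hw, mean_const]
  rw [hcoin, mean_bool, uniformLE_true, uniformLE_false hε', ← hq]
  have hwp : 0 < exploreWeight ε l := Real.exp_pos _
  rw [← ENNReal.ofReal_mul hq0, ← ENNReal.ofReal_mul (by linarith), ← ENNReal.ofReal_add
    (by positivity) (mul_nonneg (by linarith) (by positivity))]
  apply ENNReal.ofReal_le_ofReal
  have h1 := Real.add_one_le_exp (-((1 - Real.exp (-1)) * q))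
  rw [Real.exp_neg ((1 - Real.exp (-1)) * q)] at h1
  have h2 : 0 < Real.exp ((1 - Real.exp (-1)) * q) := Real.exp_pos _
  have h3 := mul_le_mul_of_nonneg_right h1 h2.le
  rw [inv_mul_cancel₀ h2.ne'] at h3
  have h4 := mul_le_mul_of_nonneg_left h3 hwp.le
  simp only [if_true, Bool.false_eq_true, if_false, Real.exp_zero]
  linarith

/-- With high probability, the number of explorations is at least half its mean. -/
lemma sum_mean_few_explorations_le (hε : ∀ n, 1 ≤ n → 0 ≤ ε n) (n T : ℕ) {x : ℝ} (hx : 0 < x)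
    (hsum : x ≤ ∑ k ∈ Finset.range n, min 1 (ε (k + 1))) :
    ∑ t ∈ Finset.range T, mean ((fairEpsGreedy R δ ε).law I t) (fun h =>
      ind (¬ (stateAfter R δ h).Identifying ∧ (stateAfter R δ h).main.length = n ∧
        (explorations (stateAfter R δ h).main : ℝ) < x / 2)) ≤
      ENNReal.ofReal (10 / x) := by
  refine sum_mean_main_event_le R δ ε I (exploreWeight ε)
    (fun h hI => mean_exploreWeight_le R δ ε I hε hI) n T ?_ (by positivity)
    (fun l => (explorations l : ℝ) < x / 2) ?_
  · simp [exploreWeight, explorations]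
  · intro l hl hlt
    unfold exploreWeight
    rw [hl, inv_div]
    have h1 : (1 : ℝ) - Real.exp (-1) ≥ 0.6 := by
      have := Real.exp_neg_one_lt_d9
      linarith
    have h2 : 0.6 * x ≤ (1 - Real.exp (-1)) * ∑ k ∈ Finset.range n, min 1 (ε (k + 1)) :=
      mul_le_mul h1 hsum hx.le (by linarith)
    -- The exponent is at least `0.6 x - 0.5 x`. Keeping only the linear part of the exponential is
    -- enough, since a failure probability `10 / x` is already of the order of the rate.
    calc x / 10 ≤ 0.1 * x + 1 := by linarith
      _ ≤ Real.exp (0.1 * x) := Real.add_one_le_exp _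
      _ ≤ _ := Real.exp_le_exp.2 (by linarith)

/-! ### The empirical preferences -/

/-- The exponential weight of the duels of `a` and `b`. -/
def duelWeight (p : ℝ) (d : Fin D) (a b : Fin K) (z lam : ℝ) (l : List (Round D K)) : ℝ :=
  Real.exp (lam * (z * (wins l d a b - p * duels l a b)) - lam ^ 2 / 8 * duels l a b)

/-- The bound holds conditionally on the two arms, so adaptive choices and exploitation rounds do no
harm. A duel in the reversed order counts through the complementary vote, whose probability is right
by `pref_add`; any other duel leaves the weight unchanged. -/
lemma mean_duelWeight_le {a b : Fin K} (hab : a ≠ b) (d : Fin D) {z : ℝ} (hz : z ^ 2 = 1) (lam : ℝ)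
    {h : History D K} (hI : ¬ (stateAfter R δ h).Identifying) :
    mean ((fairEpsGreedy R δ ε).step I h)
      (fun h' => ENNReal.ofReal (duelWeight (I.pref d a b) d a b z lam
        (stateAfter R δ h').main)) ≤
        ENNReal.ofReal (duelWeight (I.pref d a b) d a b z lam (stateAfter R δ h).main) := by
  rw [Agent.mean_step]
  simp only [main_cons_not_identifying R δ hI]
  generalize (stateAfter R δ h).main = l
  refine mean_le_const _ fun c => mean_le_const _ fun i => mean_le_const _ fun j => ?_
  have hwp : 0 < duelWeight (I.pref d a b) d a b z lam l := Real.exp_pos _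
  have hp := I.pref_mem d a b
  have hmgf := bernoulli_mgf_neg_le hp lam z hz
  have hmul := mul_le_mul_of_nonneg_left hmgf hwp.le
  by_cases h1 : i = a ∧ j = b
  · obtain ⟨rfl, rfl⟩ := h1
    have hw : ∀ y : Fin D → Bool, duelWeight (I.pref d i j) d i j z lam (⟨c, i, j, y⟩ :: l) =
        duelWeight (I.pref d i j) d i j z lam l * Real.exp (lam * (z * ((if y d then 1 else 0) -
          I.pref d i j)) - lam ^ 2 / 8) := by
      intro y
      unfold duelWeight
      rw [← Real.exp_add]
      congr 1
      unfold wins duels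
      rw [List.countP_cons, List.countP_cons]
      cases hy : y d <;> simp [hab, hab.symm, hy] <;> ring
    simp only [hw]
    rw [I.mean_feedback i j d (fun b => duelWeight (I.pref d i j) d i j z lam l * Real.exp (lam *
      (z * ((if b then 1 else 0) - I.pref d i j)) - lam ^ 2 / 8)) (fun b => by positivity)]
    apply ENNReal.ofReal_le_ofReal
    simp only [if_true, Bool.false_eq_true, if_false]
    linarith
  by_cases h2 : i = b ∧ j = a
  · obtain ⟨rfl, rfl⟩ := h2
    have hw : ∀ y : Fin D → Bool, duelWeight (I.pref d j i) d j i z lam (⟨c, i, j, y⟩ :: l) =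
        duelWeight (I.pref d j i) d j i z lam l * Real.exp (lam * (z * ((if y d then 0 else 1) -
          I.pref d j i)) - lam ^ 2 / 8) := by
      intro y
      unfold duelWeight
      rw [← Real.exp_add]
      congr 1
      unfold wins duels
      rw [List.countP_cons, List.countP_cons]
      cases hy : y d <;> simp [hab, hab.symm, hy] <;> ring
    simp only [hw]
    rw [I.mean_feedback i j d (fun b => duelWeight (I.pref d j i) d j i z lam l * Real.exp (lam *
      (z * ((if b then 0 else 1) - I.pref d j i)) - lam ^ 2 / 8)) (fun b => by positivity)]
    apply ENNReal.ofReal_le_ofReal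
    have hadd := I.pref_add d i j
    have h3 : I.pref d i j = 1 - I.pref d j i := by linarith
    rw [h3]
    simp only [if_true, Bool.false_eq_true, if_false]
    linarith
  · refine mean_le_const _ fun y => le_of_eq ?_
    congr 1
    unfold duelWeight wins duels
    rw [List.countP_cons, List.countP_cons]
    have h3 : ¬ ((i = a ∧ j = b) ∨ (i = b ∧ j = a)) := by tauto
    have h4 : ¬ ((i = a ∧ j = b ∧ y d = true) ∨ (i = b ∧ j = a ∧ y d = false)) := by tauto
    simp only [h3, h4, decide_false, Bool.false_eq_true, if_false, add_zero]

/-- With high probability, an empirical preference that is based on many duels is accurate. -/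
lemma sum_mean_inaccurate_le {a b : Fin K} (hab : a ≠ b) (d : Fin D) {z : ℝ} (hz : z ^ 2 = 1)
    (n T : ℕ) {η x : ℝ} (hη : 0 ≤ η) :
    ∑ t ∈ Finset.range T, mean ((fairEpsGreedy R δ ε).law I t) (fun h =>
      ind (¬ (stateAfter R δ h).Identifying ∧ (stateAfter R δ h).main.length = n ∧
        (x ≤ duels (stateAfter R δ h).main a b ∧
          η * duels (stateAfter R δ h).main a b < z * (wins (stateAfter R δ h).main d a b -
            I.pref d a b * duels (stateAfter R δ h).main a b)))) ≤
      ENNReal.ofReal (Real.exp (-(2 * η ^ 2 * x))) := by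
  -- The tilt `4 η` maximizes `lam * η - lam ^ 2 / 8`, with value `2 η ^ 2` per duel.
  refine sum_mean_main_event_le R δ ε I (duelWeight (I.pref d a b) d a b z (4 * η))
    (fun h hI => mean_duelWeight_le R δ ε I hab d hz _ hI) n T ?_ (Real.exp_pos _)
    (fun l => x ≤ duels l a b ∧ η * duels l a b < z * (wins l d a b - I.pref d a b * duels l a b))
    ?_
  · simp [duelWeight, wins, duels]
  · rintro l - ⟨h1, h2⟩
    rw [← Real.exp_neg, neg_neg]
    unfold duelWeight
    apply Real.exp_le_exp.2
    have h3 := mul_le_mul_of_nonneg_left h2.le (by positivity : 0 ≤ 4 * η)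
    have h4 := mul_le_mul_of_nonneg_left h1 (by positivity : 0 ≤ 2 * η ^ 2)
    nlinarith

end main

/-! ### Nash social welfare -/

section nsw

variable {D K : ℕ}

/-- Telescoping over the factors. The `y i` stand for empirical scores and may exceed one, so their
partial products are bounded by powers of `1 + θ` instead. -/
lemma abs_prod_sub_prod_le {ι : Type*} (s : Finset ι) (x y : ι → ℝ) {θ : ℝ}
    (hx0 : ∀ i, 0 ≤ x i) (hx1 : ∀ i, x i ≤ 1) (hθ : 0 ≤ θ) (hxy : ∀ i, |x i - y i| ≤ θ) :
    |∏ i ∈ s, x i - ∏ i ∈ s, y i| ≤ (1 + θ) ^ s.card - 1 := by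
  classical
  induction s using Finset.induction_on with
  | empty => simp
  | insert i s hi ih =>
    rw [Finset.prod_insert hi, Finset.prod_insert hi, Finset.card_insert_of_notMem hi, pow_succ]
    set X := ∏ i ∈ s, x i
    set Y := ∏ i ∈ s, y i
    have hX0 : 0 ≤ X := Finset.prod_nonneg fun i _ => hx0 i
    have hX1 : X ≤ 1 := Finset.prod_le_one (fun i _ => hx0 i) fun i _ => hx1 i
    have hY : |Y| ≤ (1 + θ) ^ s.card := by
      have h1 := abs_sub_abs_le_abs_sub Y X
      rw [abs_sub_comm, abs_of_nonneg hX0] at h1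
      linarith
    have h2 : x i * X - y i * Y = x i * (X - Y) + (x i - y i) * Y := by ring
    have h3 : |x i * (X - Y)| ≤ (1 + θ) ^ s.card - 1 := by
      rw [abs_mul, abs_of_nonneg (hx0 i)]
      exact (mul_le_of_le_one_left (abs_nonneg _) (hx1 i)).trans ih
    have h4 : |(x i - y i) * Y| ≤ θ * (1 + θ) ^ s.card := by
      rw [abs_mul]
      exact mul_le_mul (hxy i) hY (abs_nonneg _) hθ
    rw [h2]
    refine (abs_add_le _ _).trans ((add_le_add h3 h4).trans (le_of_eq (by ring)))

lemma sum_toReal_eq_one (π : PMF (Fin K)) : ∑ a, (π a).toReal = 1 := by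
  rw [← ENNReal.toReal_sum fun a _ => π.apply_ne_top a, ← tsum_fintype (L := .unconditional _),
    π.tsum_coe]
  rfl

variable {s : Fin D → Fin K → ℝ}

lemma nsw_nonneg (π : PMF (Fin K)) (h0 : ∀ d a, 0 ≤ s d a) : 0 ≤ nsw π s :=
  Finset.prod_nonneg fun d _ => Finset.sum_nonneg fun a _ =>
    mul_nonneg ENNReal.toReal_nonneg (h0 d a)

lemma sum_mul_score_le_one (π : PMF (Fin K)) (h1 : ∀ d a, s d a ≤ 1) (d : Fin D) :
    ∑ a, (π a).toReal * s d a ≤ 1 := by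
  rw [← sum_toReal_eq_one π]
  exact Finset.sum_le_sum fun a _ => mul_le_of_le_one_right ENNReal.toReal_nonneg (h1 d a)

lemma nsw_le_one (π : PMF (Fin K)) (h0 : ∀ d a, 0 ≤ s d a) (h1 : ∀ d a, s d a ≤ 1) :
    nsw π s ≤ 1 :=
  Finset.prod_le_one (fun d _ => Finset.sum_nonneg fun a _ =>
    mul_nonneg ENNReal.toReal_nonneg (h0 d a)) fun d _ => sum_mul_score_le_one π h1 d

/-- Averaging over a policy does not increase the error of the scores, and `(1 + θ) ^ D - 1 ≤ exp (D
θ) - 1 ≤ 2 D θ` as long as `D θ ≤ 1`. -/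
lemma abs_nsw_sub_le (π : PMF (Fin K)) {s' : Fin D → Fin K → ℝ} (h0 : ∀ d a, 0 ≤ s d a)
    (h1 : ∀ d a, s d a ≤ 1) {θ : ℝ} (hθ : 0 ≤ θ) (hs : ∀ d a, |s d a - s' d a| ≤ θ)
    (hD : D * θ ≤ 1) : |nsw π s - nsw π s'| ≤ 2 * (D * θ) := by
  have h2 : |nsw π s - nsw π s'| ≤ (1 + θ) ^ (Finset.univ : Finset (Fin D)).card - 1 := by
    refine abs_prod_sub_prod_le _ _ _ (fun d => Finset.sum_nonneg fun a _ =>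
      mul_nonneg ENNReal.toReal_nonneg (h0 d a)) (fun d => sum_mul_score_le_one π h1 d) hθ ?_
    intro d
    rw [← Finset.sum_sub_distrib]
    calc |∑ a, ((π a).toReal * s d a - (π a).toReal * s' d a)|
        ≤ ∑ a, |(π a).toReal * s d a - (π a).toReal * s' d a| := Finset.abs_sum_le_sum_abs _ _
      _ ≤ ∑ a, (π a).toReal * θ := by
          refine Finset.sum_le_sum fun a _ => ?_
          rw [← mul_sub, abs_mul, abs_of_nonneg ENNReal.toReal_nonneg]
          exact mul_le_mul_of_nonneg_left (hs d a) ENNReal.toReal_nonneg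
      _ = θ := by rw [← Finset.sum_mul, sum_toReal_eq_one, one_mul]
  rw [Finset.card_univ, Fintype.card_fin] at h2
  have hDθ : 0 ≤ D * θ := by positivity
  have h3 : (1 + θ) ^ D ≤ Real.exp (D * θ) := by
    rw [Real.exp_nat_mul]
    refine pow_le_pow_left₀ (by linarith) ?_ D
    linarith [Real.add_one_le_exp θ]
  have h4 := Real.abs_exp_sub_one_le (x := D * θ) (by rwa [abs_of_nonneg hDθ])
  rw [abs_of_nonneg hDθ] at h4
  linarith [le_abs_self (Real.exp (D * θ) - 1)]

/-- The welfare lost by optimizing for inexact scores. -/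
lemma nsw_sub_le_of_optimal {π π' : PMF (Fin K)} {s' : Fin D → Fin K → ℝ}
    (h0 : ∀ d a, 0 ≤ s d a) (h1 : ∀ d a, s d a ≤ 1) {θ : ℝ} (hθ : 0 ≤ θ)
    (hs : ∀ d a, |s d a - s' d a| ≤ θ) (hπ' : IsOptimal π' s') :
    nsw π s - nsw π' s ≤ 4 * (D * θ) := by
  by_cases hD : D * θ ≤ 1
  · have h2 := abs_le.1 (abs_nsw_sub_le π h0 h1 hθ hs hD)
    have h3 := abs_le.1 (abs_nsw_sub_le π' h0 h1 hθ hs hD)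
    have h4 := hπ' π
    linarith [h2.2, h3.1]
  -- For `D θ > 1` the claim is trivial, because the true welfare lies in `[0, 1]`.
  · have h2 := nsw_le_one π h0 h1
    have h3 := nsw_nonneg π' h0
    linarith [not_le.1 hD]

end nsw

/-! ### Ranges of the scores and of the loss of a round -/

section score

variable {D K : ℕ} {I : Instance D K} {w : Fin D → Fin K}

lemma Instance.pref_self (d : Fin D) (a : Fin K) : I.pref d a a = 1 / 2 := by
  linarith [I.pref_add d a a]

lemma score_nonneg (d : Fin D) (a : Fin K) : 0 ≤ I.score w d a :=
  mul_nonneg zero_le_two (I.pref_mem d a (w d)).1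

lemma score_le_one (hw : ∀ d, I.IsCondorcetWinner d (w d)) (d : Fin D) (a : Fin K) :
    I.score w d a ≤ 1 := by
  unfold Instance.score
  by_cases h : a = w d
  · rw [h, I.pref_self]
    norm_num
  · linarith [hw d a h, I.pref_add d a (w d)]

lemma gap_le_one (A : Agent D K) (hw : ∀ d, I.IsCondorcetWinner d (w d)) (πs : PMF (Fin K))
    (h : History D K) (c : Bool) : A.gap (I.score w) πs h c ≤ 1 := by
  have h1 := nsw_le_one πs (s := I.score w) score_nonneg (score_le_one hw)
  have h2 := nsw_nonneg (A.policies h c).1 (s := I.score w) score_nonneg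
  have h3 := nsw_nonneg (A.policies h c).2 (s := I.score w) score_nonneg
  unfold Agent.gap
  linarith

end score

/-! ### The round robin schedule -/

section roundRobin

variable {D K : ℕ} (R : Choices D K) (δ : ℝ) (ε : ℕ → ℝ) (I : Instance D K)

lemma length_order (Q : Finset (Fin K × Fin K)) : (R.order Q).length = Q.card := by
  have h : (R.order Q).toFinset = Q := by
    ext x
    simp [R.mem_order]
  rw [← List.toFinset_card_of_nodup (R.order_nodup Q), h]

variable [NeZero K]

lemma nextPair_eq {σ : State D K} {k : ℕ} {x : Fin K × Fin K}
    (hx : (R.order σ.pairs)[k]? = some x)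
    (hk : explorations σ.main % (R.order σ.pairs).length = k) : nextPair R σ = x := by
  unfold nextPair
  unfold explorations at hk
  rw [hk, List.getD_eq_getElem?_getD, hx, Option.getD_some]

/-- In every history that can occur, a pair has been played at least as often as it was scheduled. -/
lemma count_le_duels (n : ℕ) (h : History D K)
    (hh : h ∈ ((fairEpsGreedy R δ ε).law I n).support)
    (hI : ¬ (stateAfter R δ h).Identifying) {k : ℕ} {x : Fin K × Fin K}
    (hx : (R.order (stateAfter R δ h).pairs)[k]? = some x) :
    Nat.count (fun j => j % (R.order (stateAfter R δ h).pairs).length = k)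
      (explorations (stateAfter R δ h).main) ≤ duels (stateAfter R δ h).main x.1 x.2 := by
  induction n generalizing h with
  | zero =>
    have : h = [] := by simpa [Agent.law] using hh
    subst this
    have h0 : explorations (stateAfter R δ []).main = 0 := rfl
    rw [h0, Nat.count_zero]
    exact Nat.zero_le _
  | succ n ih =>
    rw [Agent.law_succ, PMF.mem_support_bind_iff] at hh
    obtain ⟨h', hh', hstep⟩ := hh
    unfold Agent.step at hstep
    simp only [PMF.mem_support_bind_iff, PMF.mem_support_map_iff] at hstep
    obtain ⟨c, hc, a, ha, b, hb, y, hy, rfl⟩ := hstep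
    by_cases hI' : (stateAfter R δ h').Identifying
    · rw [main_cons_identifying R δ hI', main_eq_nil_of_identifying R δ h' hI']
      simp [explorations]
    · rw [stateAfter_cons_not_identifying R δ hI'] at hx ⊢
      -- The set of pairs depends only on the candidate sets, which no longer change, so the
      -- schedule is fixed during the main loop.
      have hpairs : ({ stateAfter R δ h' with
          main := (⟨c, a, b, y⟩ : Round D K) :: (stateAfter R δ h').main } : State D K).pairs =
          (stateAfter R δ h').pairs := rfl
      rw [hpairs] at hx ⊢
      have hih := ih h' hh' hI' hx
      dsimp only
      have hmono : duels (stateAfter R δ h').main x.1 x.2 ≤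
          duels ((⟨c, a, b, y⟩ : Round D K) :: (stateAfter R δ h').main) x.1 x.2 := by
        unfold duels
        rw [List.countP_cons]
        exact Nat.le_add_right _ _
      rcases c with _ | _
      · have h1 : explorations ((⟨false, a, b, y⟩ : Round D K) :: (stateAfter R δ h').main) =
            explorations (stateAfter R δ h').main := by
          simp [explorations]
        rw [h1]
        exact hih.trans hmono
      · have h1 : explorations ((⟨true, a, b, y⟩ : Round D K) :: (stateAfter R δ h').main) =
            explorations (stateAfter R δ h').main + 1 := by
          simp [explorations]
        rw [h1, Nat.count_succ]
        split_ifs with hk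
        -- An exploration plays point masses, so in a history of positive probability the arms are
        -- the scheduled ones.
        · have hnext := nextPair_eq R hx hk
          have ha' : a = x.1 := by
            simpa [fairEpsGreedy, hI', hnext] using ha
          have hb' : b = x.2 := by
            simpa [fairEpsGreedy, hI', hnext] using hb
          refine (Nat.succ_le_succ hih).trans (le_of_eq ?_)
          unfold duels
          rw [List.countP_cons]
          simp [ha', hb']
        · exact hih.trans hmono

lemma card_pairs_le {σ : State D K} {w : Fin D → Fin K} (hw : ∀ d, σ.winner d = w d) :
    σ.pairs.card ≤ (Finset.univ.image w).card * K := by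
  have hsub : σ.pairs ⊆ (Finset.univ : Finset (Fin K)) ×ˢ (Finset.univ.image w) := by
    intro x hx
    obtain ⟨d, hd⟩ := (Finset.mem_filter.1 hx).2.2
    refine Finset.mem_product.2 ⟨Finset.mem_univ _, Finset.mem_image.2 ⟨d, Finset.mem_univ d, ?_⟩⟩
    rw [hd, hw]
  refine (Finset.card_le_card hsub).trans (le_of_eq ?_)
  rw [Finset.card_product, Finset.card_univ, Fintype.card_fin, mul_comm]

/-- Each residue class modulo the length of the schedule is hit at least `⌊explorations / length⌋`
times, and the schedule has at most `m K` pairs. -/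
lemma div_le_duels (n : ℕ) (h : History D K)
    (hh : h ∈ ((fairEpsGreedy R δ ε).law I n).support)
    (hI : ¬ (stateAfter R δ h).Identifying) {w : Fin D → Fin K}
    (hw : ∀ d, (stateAfter R δ h).winner d = w d) {a : Fin K} {d : Fin D} (ha : a ≠ w d) :
    explorations (stateAfter R δ h).main / ((Finset.univ.image w).card * K) ≤
      duels (stateAfter R δ h).main a (w d) := by
  have hmem : (a, w d) ∈ R.order (stateAfter R δ h).pairs := by
    rw [R.mem_order]
    exact Finset.mem_filter.2 ⟨Finset.mem_univ _, ha, d, (hw d).symm⟩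
  obtain ⟨k, hk, hx⟩ := List.getElem_of_mem hmem
  have h1 := count_le_duels R δ ε I n h hh hI (k := k) (x := (a, w d))
    (by rw [List.getElem?_eq_getElem hk, hx])
  refine le_trans ?_ h1
  have hL : 0 < (R.order (stateAfter R δ h).pairs).length := by omega
  have h2 := Nat.count_modEq_card (explorations (stateAfter R δ h).main) hL k
  have h3 : (fun j => j ≡ k [MOD (R.order (stateAfter R δ h).pairs).length]) =
      fun j => j % (R.order (stateAfter R δ h).pairs).length = k := by
    funext j
    rw [Nat.ModEq, Nat.mod_eq_of_lt hk]
  have h4 : explorations (stateAfter R δ h).main / ((Finset.univ.image w).card * K) ≤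
      explorations (stateAfter R δ h).main / (R.order (stateAfter R δ h).pairs).length := by
    refine Nat.div_le_div_left ?_ hL
    rw [length_order]
    exact card_pairs_le hw
  refine h4.trans ?_
  simp only [h3] at h2
  convert Nat.le.intro h2.symm

end roundRobin

/-! ### The loss of an exploitation round -/

section exploit

variable {D K : ℕ} [NeZero K] {R : Choices D K} {δ : ℝ} {ε : ℕ → ℝ} {I : Instance D K}
  {w : Fin D → Fin K}

/-- Frequencies accurate up to `η` give scores accurate up to `2 η`, and optimizing for these loses
at most `4 D (2 η)`. Positive duel counts make the frequencies meaningful; the diagonal is known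
exactly. -/
lemma gap_exploit_le (hw : ∀ d, I.IsCondorcetWinner d (w d)) (πs : PMF (Fin K))
    {h : History D K} (hI : ¬ (stateAfter R δ h).Identifying)
    (hwin : ∀ d, (stateAfter R δ h).winner d = w d) {η : ℝ} (hη : 0 ≤ η)
    (hpos : ∀ d a, a ≠ w d → 0 < duels (stateAfter R δ h).main a (w d))
    (hacc : ∀ d a, a ≠ w d → ∀ b, sgn b * (wins (stateAfter R δ h).main d a (w d) -
      I.pref d a (w d) * duels (stateAfter R δ h).main a (w d)) ≤
        η * duels (stateAfter R δ h).main a (w d)) :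
    (fairEpsGreedy R δ ε).gap (I.score w) πs h false ≤ 8 * (D * η) := by
  have h1 : ((fairEpsGreedy R δ ε).policies h false) =
      (R.best h (stateAfter R δ h).empiricalScore, R.best h (stateAfter R δ h).empiricalScore) := by
    simp [fairEpsGreedy, hI]
  unfold Agent.gap
  rw [h1]
  have h2 := nsw_sub_le_of_optimal (π := πs) (s := I.score w) score_nonneg (score_le_one hw)
    (θ := 2 * η) (by positivity) ?_ (R.best_spec h (stateAfter R δ h).empiricalScore)
  · dsimp only
    linarith
  · intro d a
    unfold Instance.score State.empiricalScore empiricalPref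
    rw [hwin]
    split_ifs with ha
    · rw [ha, I.pref_self]
      simpa using hη
    · have hd : (0 : ℝ) < duels (stateAfter R δ h).main a (w d) := by
        exact_mod_cast hpos d a ha
      have h3 := hacc d a ha true
      have h4 := hacc d a ha false
      simp only [sgn, if_true, Bool.false_eq_true, if_false] at h3 h4
      rw [← mul_sub, abs_mul, abs_two]
      refine mul_le_mul_of_nonneg_left ?_ zero_le_two
      rw [abs_sub_comm, div_sub' hd.ne', abs_div, abs_of_pos hd, div_le_iff₀ hd]
      exact abs_le.2 ⟨by linarith, by linarith⟩

end exploit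

/-! ### Decomposition of the regret -/

section decomposition

variable {D K : ℕ} {R : Choices D K} {δ : ℝ} {ε : ℕ → ℝ} {I : Instance D K}
  {w : Fin D → Fin K}

/-- The expected regret of the next round. -/
def roundRegret (A : Agent D K) (s : Fin D → Fin K → ℝ) (πs : PMF (Fin K)) (h : History D K) :
    ℝ≥0∞ :=
  mean (A.coin h) fun c => ENNReal.ofReal (A.gap s πs h c)

lemma roundRegret_le_one (A : Agent D K) (hw : ∀ d, I.IsCondorcetWinner d (w d))
    (πs : PMF (Fin K)) (h : History D K) : roundRegret A (I.score w) πs h ≤ 1 :=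
  mean_le_const _ fun c => ENNReal.ofReal_le_one.2 (gap_le_one A hw πs h c)

lemma length_of_mem_support (A : Agent D K) (n : ℕ) (h : History D K)
    (hh : h ∈ (A.law I n).support) : h.length = n := by
  induction n generalizing h with
  | zero =>
    have : h = [] := by simpa [Agent.law] using hh
    simp [this]
  | succ n ih =>
    rw [Agent.law_succ, PMF.mem_support_bind_iff] at hh
    obtain ⟨h', hh', hstep⟩ := hh
    unfold Agent.step at hstep
    simp only [PMF.mem_support_bind_iff, PMF.mem_support_map_iff] at hstep
    obtain ⟨c, -, a, -, b, -, y, -, rfl⟩ := hstep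
    rw [List.length_cons, ih h' hh']

lemma main_length_le (h : History D K) : (stateAfter R δ h).main.length ≤ h.length := by
  induction h with
  | nil => simp [stateAfter, State.init]
  | cons o h ih =>
    by_cases hI : (stateAfter R δ h).Identifying
    · rw [main_cons_identifying R δ hI, List.length_cons]
      omega
    · rw [main_cons_not_identifying R δ hI, List.length_cons, List.length_cons]
      omega

/-- The history is reliable and ends before round `n` (counted from `0`) of the main loop. -/
def InRound (R : Choices D K) (δ : ℝ) (I : Instance D K) (n : ℕ) (h : History D K) : Prop :=
  (¬ (stateAfter R δ h).Identifying ∧ (stateAfter R δ h).main.length = n) ∧ Reliable R δ I h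

variable [NeZero K]

/-- A round after a reliable history is either an identification round, hence among the first `B`,
or it has a definite main-loop index `n < T`. Unreliable histories cost at most one with probability
at most `δ`. -/
lemma sum_roundRegret_le (hw : ∀ d, I.IsCondorcetWinner d (w d)) (πs : PMF (Fin K))
    (hD : 1 ≤ D) (hδ : 0 < δ) (hδ1 : δ ≤ 1) {B : ℕ}
    (hB : ∀ h, Reliable R δ I h → (stateAfter R δ h).Identifying → h.length < B) (T : ℕ) :
    ∑ t ∈ Finset.range T, mean ((fairEpsGreedy R δ ε).law I t)
        (roundRegret (fairEpsGreedy R δ ε) (I.score w) πs) ≤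
      B + T * ENNReal.ofReal δ + ∑ n ∈ Finset.range T, ∑ t ∈ Finset.range T,
        mean ((fairEpsGreedy R δ ε).law I t) fun h =>
          ind (InRound R δ I n h) * roundRegret (fairEpsGreedy R δ ε) (I.score w) πs h := by
  have hpt : ∀ t ∈ Finset.range T, mean ((fairEpsGreedy R δ ε).law I t)
        (roundRegret (fairEpsGreedy R δ ε) (I.score w) πs) ≤
      ind (t < B) + ENNReal.ofReal δ + ∑ n ∈ Finset.range T,
        mean ((fairEpsGreedy R δ ε).law I t) fun h =>
          ind (InRound R δ I n h) * roundRegret (fairEpsGreedy R δ ε) (I.score w) πs h := by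
    intro t ht
    refine le_trans (mean_mono_support _ (g := fun h => ind (t < B) + ind (¬ Reliable R δ I h) +
      ∑ n ∈ Finset.range T, ind (InRound R δ I n h) *
        roundRegret (fairEpsGreedy R δ ε) (I.score w) πs h) ?_) ?_
    · intro h hh
      have hlen := length_of_mem_support _ t h hh
      have h1 := roundRegret_le_one (fairEpsGreedy R δ ε) hw πs h
      by_cases hr : Reliable R δ I h
      · by_cases hI : (stateAfter R δ h).Identifying
        · have hlt := hB h hr hI
          rw [hlen] at hlt
          rw [ind_of hlt, add_assoc]
          exact h1.trans le_self_add
        · have hn : (stateAfter R δ h).main.length ∈ Finset.range T := by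
            have := main_length_le (R := R) (δ := δ) h
            rw [Finset.mem_range] at ht ⊢
            omega
          refine le_trans ?_ le_add_self
          refine le_trans (le_of_eq ?_) (Finset.single_le_sum (fun _ _ => zero_le) hn)
          rw [ind_of ⟨⟨hI, rfl⟩, hr⟩, one_mul]
      · rw [ind_of hr, add_assoc]
        exact (h1.trans le_self_add).trans le_add_self
    · simp only [mean_add, mean_const, mean_sum]
      gcongr
      exact mean_not_reliable_le R δ I ε hD hδ hδ1 t
  have hBsum : ∑ t ∈ Finset.range T, ind (t < B) ≤ (B : ℝ≥0∞) := by
    have hind : ∀ t, ind (t < B) = if t < B then 1 else 0 := by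
      intro t
      unfold ind
      split_ifs <;> rfl
    simp only [hind]
    rw [Finset.sum_ite, Finset.sum_const_zero, add_zero, Finset.sum_const, nsmul_one]
    have : (Finset.range T).filter (· < B) ⊆ Finset.range B := fun t ht =>
      Finset.mem_range.2 (Finset.mem_filter.1 ht).2
    exact_mod_cast (Finset.card_le_card this).trans_eq (Finset.card_range B)
  refine (Finset.sum_le_sum hpt).trans ?_
  rw [Finset.sum_add_distrib, Finset.sum_add_distrib, Finset.sum_const, Finset.card_range,
    nsmul_eq_mul, Finset.sum_comm]
  gcongr

lemma roundRegret_le_of_not_identifying (hw : ∀ d, I.IsCondorcetWinner d (w d)) (πs : PMF (Fin K))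
    {h : History D K} (hI : ¬ (stateAfter R δ h).Identifying)
    (hε : 0 ≤ ε ((stateAfter R δ h).main.length + 1)) {x : ℝ} (hx0 : 0 ≤ x)
    (hx : (fairEpsGreedy R δ ε).gap (I.score w) πs h false ≤ x) :
    roundRegret (fairEpsGreedy R δ ε) (I.score w) πs h ≤
      ENNReal.ofReal (ε ((stateAfter R δ h).main.length + 1) + x) := by
  unfold roundRegret
  have hcoin : (fairEpsGreedy R δ ε).coin h =
      uniformLE (ε ((stateAfter R δ h).main.length + 1)) := by
    simp [fairEpsGreedy, hI]
  rw [hcoin, mean_bool, uniformLE_true, ENNReal.ofReal_add hε hx0]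
  refine add_le_add ?_ ?_
  · refine le_trans (mul_le_of_le_one_right' ?_) (ENNReal.ofReal_le_ofReal (min_le_right _ _))
    exact ENNReal.ofReal_le_one.2 (gap_le_one _ hw πs h true)
  · exact le_trans (mul_le_of_le_one_left' (PMF.coe_le_one _ _)) (ENNReal.ofReal_le_ofReal hx)

/-- The expected regret of round `n` of the main loop. -/
lemma sum_mean_inRound_le (hw : ∀ d, I.IsCondorcetWinner d (w d)) (πs : PMF (Fin K))
    (hε : ∀ n, 1 ≤ n → 0 ≤ ε n)
    (hwin : ∀ h, Reliable R δ I h → ¬ (stateAfter R δ h).Identifying →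
      ∀ d, (stateAfter R δ h).winner d = w d) (n T : ℕ) {x k₀ η : ℝ} (hx : 0 < x) (hη : 0 ≤ η)
    (hsum : x ≤ ∑ k ∈ Finset.range n, min 1 (ε (k + 1))) (hk₀ : 0 < k₀)
    (hfloor : ∀ N : ℕ, x / 2 ≤ N → k₀ ≤ (N / ((Finset.univ.image w).card * K) : ℕ)) :
    ∑ t ∈ Finset.range T, mean ((fairEpsGreedy R δ ε).law I t) (fun h =>
        ind (InRound R δ I n h) * roundRegret (fairEpsGreedy R δ ε) (I.score w) πs h) ≤
      ENNReal.ofReal (ε (n + 1) + 8 * (D * η) + 10 / x +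
        2 * (D * K) * Real.exp (-(2 * η ^ 2 * k₀))) := by
  let A : History D K → Prop := fun h =>
    ¬ (stateAfter R δ h).Identifying ∧ (stateAfter R δ h).main.length = n
  let few : History D K → Prop := fun h => ¬ (stateAfter R δ h).Identifying ∧
    (stateAfter R δ h).main.length = n ∧ (explorations (stateAfter R δ h).main : ℝ) < x / 2
  -- Neither this event nor `few` mentions reliability, so both are controlled by the unconditional
  -- supermartingale bounds. Outside of them, reliability identifies the winners and the
  -- exploitation loss is `8 D η`.
  let bad : Fin D × Fin K × Bool → History D K → Prop := fun p h => p.2.1 ≠ w p.1 ∧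
    (¬ (stateAfter R δ h).Identifying ∧ (stateAfter R δ h).main.length = n ∧
        (k₀ ≤ duels (stateAfter R δ h).main p.2.1 (w p.1) ∧
          η * duels (stateAfter R δ h).main p.2.1 (w p.1) <
            sgn p.2.2 * (wins (stateAfter R δ h).main p.1 p.2.1 (w p.1) -
            I.pref p.1 p.2.1 (w p.1) * duels (stateAfter R δ h).main p.2.1 (w p.1))))
  have hεn := hε (n + 1) (Nat.succ_pos n)
  have hpt : ∀ t ∈ Finset.range T, mean ((fairEpsGreedy R δ ε).law I t) (fun h =>
        ind (InRound R δ I n h) * roundRegret (fairEpsGreedy R δ ε) (I.score w) πs h) ≤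
      mean ((fairEpsGreedy R δ ε).law I t) fun h =>
        ENNReal.ofReal (ε (n + 1) + 8 * (D * η)) * ind (A h) + ind (few h) + ∑ p, ind (bad p h) := by
    intro t _
    refine mean_mono_support _ fun h hh => ?_
    by_cases hR : InRound R δ I n h
    swap
    · rw [ind_of_not hR, zero_mul]
      exact zero_le
    have h1 := roundRegret_le_one (fairEpsGreedy R δ ε) hw πs h
    rw [ind_of hR, one_mul]
    obtain ⟨⟨hI, hlen⟩, hr⟩ := hR
    have hA : A h := ⟨hI, hlen⟩
    by_cases hfew : few h
    · rw [ind_of hfew]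
      exact (h1.trans le_add_self).trans le_self_add
    by_cases hbad : ∃ p, bad p h
    · obtain ⟨p, hp⟩ := hbad
      refine le_trans ?_ le_add_self
      refine le_trans ?_ (Finset.single_le_sum (fun _ _ => zero_le) (Finset.mem_univ p))
      rwa [ind_of hp]
    refine le_trans ?_ (le_self_add.trans le_self_add)
    rw [ind_of hA, mul_one]
    have hwd := hwin h hr hI
    have hmany : x / 2 ≤ explorations (stateAfter R δ h).main := by
      by_contra! hlt
      exact hfew ⟨hI, hlen, hlt⟩
    have hduels : ∀ d a, a ≠ w d → k₀ ≤ duels (stateAfter R δ h).main a (w d) := by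
      intro d a ha
      refine (hfloor _ hmany).trans ?_
      exact_mod_cast div_le_duels R δ ε I t h hh hI hwd ha
    have hgap := gap_exploit_le (ε := ε) hw πs hI hwd hη (fun d a ha => by
      exact_mod_cast hk₀.trans_le (hduels d a ha)) (fun d a ha b => by
      by_contra! hlt
      exact hbad ⟨(d, a, b), ha, hI, hlen, hduels d a ha, hlt⟩)
    have := roundRegret_le_of_not_identifying hw πs hI (by rw [hlen]; exact hεn)
      (by positivity) hgap
    rwa [hlen] at this
  refine (Finset.sum_le_sum hpt).trans ?_
  simp only [mean_add, mean_mul_left, mean_sum, Finset.sum_add_distrib, ← Finset.mul_sum]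
  rw [ENNReal.ofReal_add (p := ε (n + 1) + 8 * (D * η) + 10 / x) (by positivity) (by positivity),
    ENNReal.ofReal_add (q := 10 / x) (by positivity) (by positivity)]
  refine add_le_add (add_le_add ?_ ?_) ?_
  · exact mul_le_of_le_one_right' (sum_mean_main_length_le R δ ε I n T)
  · exact sum_mean_few_explorations_le R δ ε I hε n T hx hsum
  · rw [Finset.sum_comm]
    calc _ ≤ ∑ p : Fin D × Fin K × Bool, ENNReal.ofReal (Real.exp (-(2 * η ^ 2 * k₀))) := by
          refine Finset.sum_le_sum fun p _ => ?_
          by_cases hp : p.2.1 = w p.1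
          · have : ∀ h, ¬ bad p h := fun h hb => hb.1 hp
            simp [ind_of_not, this, mean_const]
          · refine le_trans (Finset.sum_le_sum fun t _ => mean_mono _ fun h =>
              ind_mono fun hb => hb.2) ?_
            exact sum_mean_inaccurate_le R δ ε I hp p.1 (sgn_sq _) n T hη
      _ = _ := by
          rw [Finset.sum_const, nsmul_eq_mul, ← ENNReal.ofReal_natCast, ← ENNReal.ofReal_mul
            (by positivity)]
          congr 2
          simp only [Finset.card_univ, Fintype.card_prod, Fintype.card_fin, Fintype.card_bool]
          push_cast
          ring

lemma sum_mean_inRound_le_one (hw : ∀ d, I.IsCondorcetWinner d (w d)) (πs : PMF (Fin K))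
    (n T : ℕ) :
    ∑ t ∈ Finset.range T, mean ((fairEpsGreedy R δ ε).law I t) (fun h =>
        ind (InRound R δ I n h) * roundRegret (fairEpsGreedy R δ ε) (I.score w) πs h) ≤ 1 := by
  refine le_trans (Finset.sum_le_sum fun t _ => mean_mono _ fun h => ?_)
    (sum_mean_main_length_le R δ ε I n T)
  exact le_trans (mul_le_of_le_one_right' (roundRegret_le_one _ hw πs h)) (ind_mono And.left)

end decomposition

/-! ### The exploration rate -/

lemma rpow_one_third_pow {x : ℝ} (hx : 0 ≤ x) : (x ^ (1 / 3 : ℝ)) ^ 3 = x := by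
  rw [← Real.rpow_natCast, ← Real.rpow_mul hx]
  norm_num

lemma rpow_two_thirds {x : ℝ} (hx : 0 ≤ x) : x ^ (2 / 3 : ℝ) = (x ^ (1 / 3 : ℝ)) ^ 2 := by
  rw [← Real.rpow_natCast, ← Real.rpow_mul hx]
  norm_num

lemma rpow_neg_one_third {x : ℝ} (hx : 0 ≤ x) : x ^ (-(1 / 3) : ℝ) = (x ^ (1 / 3 : ℝ))⁻¹ :=
  Real.rpow_neg hx _

/-- With `a` and `b` the cube roots of `n + 1` and `n`, the induction step is `2 (a ^ 3 - b ^ 3) ≤ 3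
a (a ^ 2 - b ^ 2)`, and the difference of the sides is `(a - b) ^ 2 (a + 2 b)`. -/
lemma sum_rpow_neg_one_third_le (T : ℕ) :
    ∑ n ∈ Finset.range T, ((n + 1 : ℕ) : ℝ) ^ (-(1 / 3) : ℝ) ≤ 3 / 2 * (T : ℝ) ^ (2 / 3 : ℝ) := by
  induction T with
  | zero => simp
  | succ n ih =>
    rw [Finset.sum_range_succ]
    refine (add_le_add_left ih _).trans ?_
    have hn : (0 : ℝ) ≤ (n : ℝ) := n.cast_nonneg
    have hn1 : (0 : ℝ) < ((n + 1 : ℕ) : ℝ) := by positivity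
    rw [rpow_two_thirds hn, rpow_two_thirds hn1.le, rpow_neg_one_third hn1.le]
    have ha := rpow_one_third_pow hn1.le
    have hb := rpow_one_third_pow hn
    have ha0 : 0 < ((n + 1 : ℕ) : ℝ) ^ (1 / 3 : ℝ) := by positivity
    have hb0 : 0 ≤ (n : ℝ) ^ (1 / 3 : ℝ) := by positivity
    generalize ((n + 1 : ℕ) : ℝ) ^ (1 / 3 : ℝ) = a at *
    generalize (n : ℝ) ^ (1 / 3 : ℝ) = b at *
    have hab : a ^ 3 - b ^ 3 = 1 := by
      rw [ha, hb]
      push_cast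
      ring
    have h1 : 0 ≤ (a - b) ^ 2 * (a + 2 * b) := by positivity
    have h2 : a⁻¹ ≤ 3 / 2 * (a ^ 2 - b ^ 2) := by
      rw [inv_le_iff_one_le_mul₀ ha0]
      nlinarith
    linarith

/-! ### Size, monotonicity and sum of the exploration rate -/

section exploreOrder

variable {D K m : ℕ}

lemma three_le_mul (hD : 1 ≤ D) (hK : 3 ≤ K) {n : ℕ} (hn : 1 ≤ n) : (3 : ℝ) ≤ (D : ℝ) * K * n := by
  have h : 1 * 3 * 1 ≤ D * K * n := Nat.mul_le_mul (Nat.mul_le_mul hD hK) hn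
  exact_mod_cast h

lemma exp_one_le_three : Real.exp 1 ≤ 3 := by linarith [Real.exp_one_lt_d9]

lemma one_le_log (hD : 1 ≤ D) (hK : 3 ≤ K) {n : ℕ} (hn : 1 ≤ n) : 1 ≤ Real.log ((D : ℝ) * K * n) := by
  have h := three_le_mul hD hK hn
  rw [Real.le_log_iff_exp_le (by linarith)]
  linarith [exp_one_le_three]

/-- Cubing removes the fractional exponents; most later comparisons with the rate go through this
identity. -/
lemma exploreOrder_pow (hD : 1 ≤ D) (hK : 3 ≤ K) {n : ℕ} (hn : 1 ≤ n) :
    exploreOrder D K m n ^ 3 = (D : ℝ) ^ 2 * K * m * Real.log ((D : ℝ) * K * n) / n := by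
  have hL := one_le_log hD hK hn
  have hn' : (0 : ℝ) ≤ n := n.cast_nonneg
  unfold exploreOrder
  rw [rpow_two_thirds D.cast_nonneg, rpow_neg_one_third hn']
  simp only [mul_pow, inv_pow]
  rw [rpow_one_third_pow hn', rpow_one_third_pow (by positivity), rpow_one_third_pow
    (by positivity), rpow_one_third_pow (by linarith), ← pow_mul, mul_comm 2 3, pow_mul,
    rpow_one_third_pow (by positivity)]
  ring

lemma exploreOrder_nonneg (n : ℕ) : 0 ≤ exploreOrder D K m n := by
  unfold exploreOrder
  have : 0 ≤ Real.log ((D : ℝ) * K * n) := by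
    have := Real.log_natCast_nonneg (D * K * n)
    exact_mod_cast this
  positivity

lemma one_le_exploreOrder_pow_mul (hD : 1 ≤ D) (hK : 3 ≤ K) (hm : 1 ≤ m) {n : ℕ} (hn : 1 ≤ n) :
    1 ≤ exploreOrder D K m n ^ 3 * n := by
  have hn' : (0 : ℝ) < n := by exact_mod_cast hn
  rw [exploreOrder_pow hD hK hn, div_mul_cancel₀ _ hn'.ne']
  have h1 : (1 : ℝ) ≤ (D : ℝ) ^ 2 := one_le_pow₀ (by exact_mod_cast hD)
  have h2 : (1 : ℝ) ≤ K := by exact_mod_cast (by omega : 1 ≤ K)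
  have h3 : (1 : ℝ) ≤ m := by exact_mod_cast hm
  have h4 := one_le_log hD hK hn
  exact one_le_mul_of_one_le_of_one_le (one_le_mul_of_one_le_of_one_le
    (one_le_mul_of_one_le_of_one_le h1 h2) h3) h4

lemma exploreOrder_pos (hD : 1 ≤ D) (hK : 3 ≤ K) (hm : 1 ≤ m) {n : ℕ} (hn : 1 ≤ n) : 0 < exploreOrder D K m n := by
  refine (exploreOrder_nonneg n).lt_of_ne fun h => ?_
  have := one_le_exploreOrder_pow_mul hD hK hm hn
  rw [← h] at this
  norm_num at this

/-- Up to a constant the cube is `log x / x` at `x = D K n ≥ 3`, and this function decreases from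
`e` on. -/
lemma exploreOrder_anti (hD : 1 ≤ D) (hK : 3 ≤ K) {k n : ℕ} (hk : 1 ≤ k) (hkn : k ≤ n) :
    exploreOrder D K m n ≤ exploreOrder D K m k := by
  have hn : 1 ≤ n := hk.trans hkn
  have hk' : (0 : ℝ) < k := by exact_mod_cast hk
  have hn' : (0 : ℝ) < n := by exact_mod_cast hn
  have hDK : (0 : ℝ) < (D : ℝ) * K := by
    have : 0 < D * K := by positivity
    exact_mod_cast this
  rw [← pow_le_pow_iff_left₀ (exploreOrder_nonneg n) (exploreOrder_nonneg k) three_ne_zero,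
    exploreOrder_pow hD hK hk, exploreOrder_pow hD hK hn]
  have hanti := Real.log_div_self_antitoneOn
    (a := (D : ℝ) * K * k) (b := (D : ℝ) * K * n)
    (exp_one_le_three.trans (three_le_mul hD hK hk))
    (exp_one_le_three.trans (three_le_mul hD hK hn)) (by gcongr)
  have key : ∀ x : ℝ, 0 < x → (D : ℝ) ^ 2 * K * m * Real.log ((D : ℝ) * K * x) / x =
      (D : ℝ) ^ 2 * K * m * (D * K) * (Real.log ((D : ℝ) * K * x) / ((D : ℝ) * K * x)) := by
    intro x hx
    field_simp
  rw [key k hk', key n hn']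
  gcongr

lemma sum_exploreOrder_le (T : ℕ) :
    ∑ n ∈ Finset.range T, exploreOrder D K m (n + 1) ≤
      3 / 2 * ((D : ℝ) ^ (2 / 3 : ℝ) * (K : ℝ) ^ (1 / 3 : ℝ) * (m : ℝ) ^ (1 / 3 : ℝ) *
        (T : ℝ) ^ (2 / 3 : ℝ) * Real.log ((D : ℝ) * K * T) ^ (1 / 3 : ℝ)) := by
  have hlog : ∀ n : ℕ, 0 ≤ Real.log ((D : ℝ) * K * n) := by
    intro n
    have := Real.log_natCast_nonneg (D * K * n)
    exact_mod_cast this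
  have hmono : ∀ n ∈ Finset.range T, exploreOrder D K m (n + 1) ≤
      (D : ℝ) ^ (2 / 3 : ℝ) * (K : ℝ) ^ (1 / 3 : ℝ) * (m : ℝ) ^ (1 / 3 : ℝ) *
        Real.log ((D : ℝ) * K * T) ^ (1 / 3 : ℝ) * ((n + 1 : ℕ) : ℝ) ^ (-(1 / 3) : ℝ) := by
    intro n hn
    have hle : Real.log ((D : ℝ) * K * (n + 1 : ℕ)) ≤ Real.log ((D : ℝ) * K * T) := by
      have h1 : D * K * (n + 1) ≤ D * K * T :=
        Nat.mul_le_mul_left _ (Finset.mem_range.1 hn)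
      rcases Nat.eq_zero_or_pos (D * K * (n + 1)) with h0 | h0
      · have h2 : (D : ℝ) * K * (n + 1 : ℕ) = 0 := by exact_mod_cast h0
        rw [h2, Real.log_zero]
        exact hlog T
      · refine Real.log_le_log (by exact_mod_cast h0) (by exact_mod_cast h1)
    unfold exploreOrder
    rw [mul_right_comm]
    have := hlog (n + 1)
    gcongr
  refine (Finset.sum_le_sum hmono).trans ?_
  rw [← Finset.mul_sum]
  have := sum_rpow_neg_one_third_le T
  have h0 := hlog T
  calc _ ≤ (D : ℝ) ^ (2 / 3 : ℝ) * (K : ℝ) ^ (1 / 3 : ℝ) * (m : ℝ) ^ (1 / 3 : ℝ) *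
        Real.log ((D : ℝ) * K * T) ^ (1 / 3 : ℝ) * (3 / 2 * (T : ℝ) ^ (2 / 3 : ℝ)) := by gcongr
    _ = _ := by ring

/-- The numerical estimate for one round of the main loop. -/
lemma sqrt_estimate (hD : 1 ≤ D) (hK : 3 ≤ K) (hm : 1 ≤ m) {c : ℝ} (hc : 0 < c) (hc1 : c ≤ 1) {N : ℕ} (hN : 1 ≤ N) {k₀ : ℝ}
    (hk₀ : k₀ = N * c * exploreOrder D K m N / (8 * (m * K))) :
    D * Real.sqrt (Real.log ((D : ℝ) * K * N) / k₀) ≤ 8 / c * exploreOrder D K m N := by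
  have he := exploreOrder_pos hD hK hm hN
  have hcube := exploreOrder_pow (m := m) hD hK hN
  have hL := one_le_log hD hK hN
  have hN' : (0 : ℝ) < N := by exact_mod_cast hN
  have hm' : (0 : ℝ) < m := by exact_mod_cast hm
  have hK' : (0 : ℝ) < K := by exact_mod_cast (by omega : 0 < K)
  have hk₀' : 0 < k₀ := by rw [hk₀]; positivity
  generalize exploreOrder D K m N = e at *
  rw [eq_div_iff hN'.ne'] at hcube
  -- The balance that dictates the rate: since `e ^ 3 * N = D ^ 2 K m log (D K N)`, the squared loss
  -- is a multiple of `e ^ 2`.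
  have h1 : (D : ℝ) ^ 2 * (Real.log ((D : ℝ) * K * N) / k₀) = 8 / c * e ^ 2 := by
    rw [hk₀]
    field_simp
    linarith
  have h2 : 8 / c * e ^ 2 ≤ (8 / c * e) ^ 2 := by
    have : 1 ≤ 8 / c := (one_le_div hc).2 (by linarith)
    rw [mul_pow]
    gcongr
    nlinarith
  rw [← pow_le_pow_iff_left₀ (by positivity) (by positivity) two_ne_zero, mul_pow,
    Real.sq_sqrt (by positivity), h1]
  exact h2

/-- This choice of accuracy makes the exponential equal to `(y N) ^ (-2)`, enough to absorb the
union bound over `2 y` events and still be of order `e`. -/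
lemma two_mul_exp_le {y N e l k₀ : ℝ} (hy : 1 ≤ y) (hN : 1 ≤ N) (he : 0 < e) (he1 : e ≤ 1)
    (hNe : 1 ≤ N * e ^ 2) (hk₀ : 0 < k₀) (hl : l = Real.log (y * N)) :
    2 * y * Real.exp (-(2 * Real.sqrt (l / k₀) ^ 2 * k₀)) ≤ 2 * e := by
  have hyN : 1 ≤ y * N := one_le_mul_of_one_le_of_one_le hy hN
  have hl0 : 0 ≤ l := hl ▸ Real.log_nonneg hyN
  have h3 : Real.sqrt (l / k₀) ^ 2 * k₀ = l := by
    rw [Real.sq_sqrt (by positivity), div_mul_cancel₀ _ hk₀.ne']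
  have h4 : Real.exp (-(2 * Real.sqrt (l / k₀) ^ 2 * k₀)) = ((y * N) ^ 2)⁻¹ := by
    rw [mul_assoc, h3, hl, Real.exp_neg, ← Nat.cast_two (R := ℝ), Real.exp_nat_mul, Real.exp_log
      (by positivity)]
  rw [h4, ← div_eq_mul_inv, div_le_iff₀ (by positivity)]
  have h5 : 1 ≤ N ^ 2 * e := by
    have h6 : e ^ 2 ≤ e := by nlinarith
    have h7 : N ≤ N ^ 2 := by nlinarith
    calc 1 ≤ N * e ^ 2 := hNe
      _ ≤ N ^ 2 * e := by gcongr
  have h8 : y ≤ y ^ 2 := by nlinarith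
  calc 2 * y = 2 * (y * 1) := by ring
    _ ≤ 2 * (y ^ 2 * (N ^ 2 * e)) := by gcongr
    _ = 2 * e * (y * N) ^ 2 := by ring

end exploreOrder

/-! ### Regret of a single main-loop round -/

section mainLoop

variable {D K : ℕ} [NeZero K] {R : Choices D K} {δ : ℝ} {ε : ℕ → ℝ} {I : Instance D K}
  {w : Fin D → Fin K}

/-- The expected regret of a round of the main loop is of the order of the exploration rate. -/
lemma sum_mean_inRound_le_exploreOrder (hD : 1 ≤ D) (hK : 3 ≤ K)
    (hw : ∀ d, I.IsCondorcetWinner d (w d)) (πs : PMF (Fin K)) {m : ℕ}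
    (hm : m = (Finset.univ.image w).card) {c c₂ : ℝ} (hc : 0 < c) (hc1 : c ≤ 1) (hc₂ : 0 ≤ c₂)
    (hε : ∀ n : ℕ, 1 ≤ n → c * exploreOrder D K m n ≤ ε n ∧ ε n ≤ c₂ * exploreOrder D K m n)
    (hwin : ∀ h, Reliable R δ I h → ¬ (stateAfter R δ h).Identifying →
      ∀ d, (stateAfter R δ h).winner d = w d) (n T : ℕ) :
    ∑ t ∈ Finset.range T, mean ((fairEpsGreedy R δ ε).law I t) (fun h =>
        ind (InRound R δ I n h) * roundRegret (fairEpsGreedy R δ ε) (I.score w) πs h) ≤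
      ENNReal.ofReal ((c₂ + 90 / c) * exploreOrder D K m (n + 1)) := by
  have hm1 : 1 ≤ m := by
    rw [hm, Nat.one_le_iff_ne_zero, Finset.card_ne_zero]
    exact ⟨w ⟨0, hD⟩, Finset.mem_image_of_mem _ (Finset.mem_univ _)⟩
  have hn1 : 1 ≤ n + 1 := Nat.succ_pos n
  have he := exploreOrder_pos hD hK hm1 hn1
  have hcube := one_le_exploreOrder_pow_mul hD hK hm1 hn1
  have hcinv : 1 ≤ 1 / c := (one_le_div hc).2 hc1
  have hN' : (0 : ℝ) < ((n + 1 : ℕ) : ℝ) := by positivity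
  have hmK : 0 < m * K := by positivity
  have hmK' : (0 : ℝ) < (m : ℝ) * K := by exact_mod_cast hmK
  -- rounds in which the claimed bound is trivial
  have htriv : c / 2 ≤ exploreOrder D K m (n + 1) →
      ∑ t ∈ Finset.range T, mean ((fairEpsGreedy R δ ε).law I t) (fun h =>
        ind (InRound R δ I n h) * roundRegret (fairEpsGreedy R δ ε) (I.score w) πs h) ≤
      ENNReal.ofReal ((c₂ + 90 / c) * exploreOrder D K m (n + 1)) := by
    intro h
    refine (sum_mean_inRound_le_one hw πs n T).trans ?_
    rw [ENNReal.one_le_ofReal]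
    have h1 : 90 / c * (c / 2) ≤ 90 / c * exploreOrder D K m (n + 1) := by gcongr
    have h2 : 90 / c * (c / 2) = 45 := by field_simp; norm_num
    nlinarith
  by_cases h1 : c / 2 ≤ exploreOrder D K m (n + 1)
  · exact htriv h1
  -- Too few explorations to visit every pair. Then `m K ≤ e ^ 3 N` forces `e ^ 2 ≥ c / 4`, hence `e
  -- ≥ c / 2`, and the trivial bound applies.
  by_cases h2 : (n + 1 : ℕ) * c * exploreOrder D K m (n + 1) < 4 * (m * K)
  · apply htriv
    have h3 := exploreOrder_pow (m := m) hD hK hn1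
    have h4 := one_le_log hD hK hn1
    rw [eq_div_iff hN'.ne'] at h3
    have h5 : (m : ℝ) * K ≤ exploreOrder D K m (n + 1) ^ 3 * (n + 1 : ℕ) := by
      rw [h3]
      have hD2 : (1 : ℝ) ≤ (D : ℝ) ^ 2 := one_le_pow₀ (by exact_mod_cast hD)
      calc (m : ℝ) * K = 1 * K * m * 1 := by ring
        _ ≤ _ := by gcongr
    have h6 : (n + 1 : ℕ) * exploreOrder D K m (n + 1) * (c / 4) ≤
        (n + 1 : ℕ) * exploreOrder D K m (n + 1) * exploreOrder D K m (n + 1) ^ 2 := by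
      nlinarith
    have h7 := le_of_mul_le_mul_left h6 (by positivity)
    nlinarith
  push Not at h1 h2
  have he1 : exploreOrder D K m (n + 1) < 1 := by linarith
  -- Before round `N = n + 1` only `n` coins have been tossed; excluding `n = 0` gives `n ≥ N / 2`.
  have hn : 1 ≤ n := by
    by_contra! h0
    have h0' : n = 0 := by omega
    subst h0'
    have : exploreOrder D K m (0 + 1) ^ 3 < 1 := pow_lt_one₀ he.le he1 (by norm_num)
    norm_num at hcube
    linarith
  have hmn : ((n + 1 : ℕ) : ℝ) / 2 ≤ n := by
    have : (1 : ℝ) ≤ n := by exact_mod_cast hn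
    push_cast
    linarith
  have hL := one_le_log hD hK hn1
  set e := exploreOrder D K m (n + 1) with hedef
  set N : ℕ := n + 1 with hNdef
  -- Here `x` bounds the expected number of explorations from below, and `k₀` is half of `x / 2`
  -- divided by `m K`; the extra half is lost to the floor in the round robin count.
  set x : ℝ := N * c * e / 2 with hx
  set k₀ : ℝ := N * c * e / (8 * (m * K)) with hk₀
  set η : ℝ := Real.sqrt (Real.log ((D : ℝ) * K * N) / k₀) with hη
  have hk₀' : 0 < k₀ := by positivity
  have hx' : 0 < x := by positivity
  have hsum : x ≤ ∑ k ∈ Finset.range n, min 1 (ε (k + 1)) := by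
    calc x = ((N : ℝ) / 2) * (c * e) := by rw [hx]; ring
      _ ≤ n * (c * e) := by gcongr
      _ = ∑ k ∈ Finset.range n, c * e := by
        rw [Finset.sum_const, Finset.card_range, nsmul_eq_mul]
      _ ≤ ∑ k ∈ Finset.range n, min 1 (ε (k + 1)) := by
        refine Finset.sum_le_sum fun k hk => le_min ?_ ?_
        · nlinarith
        · refine le_trans ?_ (hε (k + 1) (Nat.succ_pos k)).1
          have := Finset.mem_range.1 hk
          exact mul_le_mul_of_nonneg_left
            (exploreOrder_anti hD hK (Nat.succ_pos k) (by omega)) hc.le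
  have hfloor : ∀ j : ℕ, x / 2 ≤ j → k₀ ≤ (j / ((Finset.univ.image w).card * K) : ℕ) := by
    intro j hj
    rw [← hm]
    have hj1 : (m : ℝ) * K ≤ j := by linarith
    have hj2 : m * K ≤ j := by exact_mod_cast hj1
    have hq : 1 ≤ j / (m * K) := (Nat.one_le_div_iff hmK).2 hj2
    have hlt := Nat.lt_mul_div_succ j hmK
    have hlt' : (j : ℝ) ≤ (m : ℝ) * K * ((j / (m * K) : ℕ) + 1) := by exact_mod_cast hlt.le
    have hq' : (1 : ℝ) ≤ (j / (m * K) : ℕ) := by exact_mod_cast hq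
    have hk : k₀ = x / 2 / (2 * (m * K)) := by
      rw [hk₀, hx]
      field_simp
      norm_num
    rw [hk, div_le_iff₀ (by positivity)]
    nlinarith
  refine (sum_mean_inRound_le hw πs (fun n hn => le_trans (mul_nonneg hc.le
    (exploreOrder_nonneg n)) (hε n hn).1) hwin n T hx' (Real.sqrt_nonneg _ : 0 ≤ η) hsum hk₀'
    hfloor).trans (ENNReal.ofReal_le_ofReal ?_)
  have b1 := (hε N hn1).2
  have b2 : D * η ≤ 8 / c * e := sqrt_estimate hD hK hm1 hc hc1 hn1 hk₀
  have hNe2 : 1 ≤ N * e ^ 2 := by nlinarith [pow_pos he 2]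
  have b3 : 10 / x ≤ 20 / c * e := by
    rw [div_le_iff₀ hx', hx]
    have : 20 / c * e * (N * c * e / 2) = 10 * (N * e ^ 2) := by
      field_simp
      norm_num
    rw [this]
    linarith
  have b4 : 2 * (D * K) * Real.exp (-(2 * η ^ 2 * k₀)) ≤ 2 * e := by
    have hDK := three_le_mul hD hK (le_refl 1)
    rw [Nat.cast_one, mul_one] at hDK
    exact two_mul_exp_le (by linarith) (by exact_mod_cast hn1) he he1.le hNe2 hk₀' rfl
  -- Where `90` comes from: `64` for exploitation, `20` for too few explorations, and `6` where `2`
  -- would do for inaccurate frequencies.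
  have h90 : 90 / c = 8 * (8 / c) + 20 / c + 6 * (1 / c) := by ring
  have hsplit : (c₂ + 90 / c) * e = c₂ * e + 8 * (8 / c * e) + 20 / c * e + 6 * (1 / c) * e := by
    rw [h90]
    ring
  have h2e : 2 * e ≤ 6 * (1 / c) * e := by nlinarith
  rw [hsplit]
  linarith

end mainLoop

/-! ### The length of the identification phase -/

/-- Take the first `r` with `width r < Δ`. By minimality `2 ^ (-r) ≥ Δ`; squaring gives the bound on
`4 ^ r`, and taking logarithms twice gives the `log log` bound on `log r`. -/
lemma exists_last_round {Δ : ℝ} (hΔ : 0 < Δ) (hΔ1 : Δ ≤ 1 / 2) :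
    ∃ r : ℕ, 1 ≤ r ∧ width r < Δ ∧ (4 : ℝ) ^ r ≤ 1 / Δ ^ 2 ∧
      Real.log r + Real.log (Real.log 2) ≤ Real.log (Real.log (1 / Δ)) := by
  classical
  have hex : ∃ r, width r < Δ := by
    obtain ⟨r, hr⟩ := exists_pow_lt_of_lt_one hΔ (by norm_num : (1 / 2 : ℝ) < 1)
    refine ⟨r, lt_of_le_of_lt ?_ hr⟩
    exact pow_le_pow_of_le_one (by norm_num) (by norm_num) (Nat.le_succ r)
  have hspec := Nat.find_spec hex
  have h1 : 1 ≤ Nat.find hex := by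
    rw [Nat.one_le_iff_ne_zero, Ne, Nat.find_eq_zero]
    simpa [width] using hΔ1
  have hmin := Nat.find_min hex (m := Nat.find hex - 1) (by omega)
  generalize Nat.find hex = r at *
  have h2 : (2 : ℝ) ^ r ≤ 1 / Δ := by
    unfold width at hmin
    rw [Nat.sub_add_cancel h1, not_lt, one_div_pow, le_div_iff₀ (by positivity)] at hmin
    rw [le_div_iff₀ hΔ]
    linarith
  have hr : (0 : ℝ) < r := by exact_mod_cast h1
  refine ⟨r, h1, hspec, ?_, ?_⟩
  · calc (4 : ℝ) ^ r = (2 ^ r) ^ 2 := by rw [← pow_mul, mul_comm, pow_mul]; norm_num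
      _ ≤ (1 / Δ) ^ 2 := by gcongr
      _ = 1 / Δ ^ 2 := one_div_pow _ _
  · have hl2 := Real.log_pos one_lt_two
    rw [← Real.log_mul hr.ne' hl2.ne']
    apply Real.log_le_log (by positivity)
    rw [← Real.log_pow]
    exact Real.log_le_log (by positivity) h2

lemma log_two_gt : 0.69 < Real.log 2 := by linarith [Real.log_two_gt_d9]

lemma log_two_lt : Real.log 2 < 0.7 := by linarith [Real.log_two_lt_d9]

lemma log_log_two_ge : -0.4 ≤ Real.log (Real.log 2) := by
  rw [Real.le_log_iff_exp_le (Real.log_pos one_lt_two), Real.exp_neg]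
  have h := Real.quadratic_le_exp_of_nonneg (x := 0.4) (by norm_num)
  calc (Real.exp 0.4)⁻¹ ≤ (1.48)⁻¹ := by
        apply inv_anti₀ (by norm_num)
        norm_num at h ⊢
        linarith
    _ ≤ 0.69 := by norm_num
    _ ≤ Real.log 2 := log_two_gt.le

lemma log_seven_bounds : 1 ≤ Real.log 7 ∧ Real.log 7 ≤ 2.1 := by
  constructor
  · rw [Real.le_log_iff_exp_le (by norm_num)]
    linarith [exp_one_le_three]
  · have h : Real.log 7 ≤ Real.log (2 ^ 3) := Real.log_le_log (by norm_num) (by norm_num)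
    rw [Real.log_pow] at h
    push_cast at h
    linarith [log_two_lt]

/-- The constant `7` exceeds `4 π ^ 2 / 6`, and replacing `8` by `9` absorbs the ceiling, the
logarithm being at least one. -/
lemma batchSize_le {δ' : ℝ} (hδ : 0 < δ') (hδ1 : δ' ≤ 1) {r rs : ℕ} (hr : 1 ≤ r) (hrs : r ≤ rs) :
    (batchSize δ' r : ℝ) ≤ 9 * Real.log (7 * rs ^ 2 / δ') * 4 ^ (r + 1) := by
  have hr' : (1 : ℝ) ≤ r := by exact_mod_cast hr
  have hrs' : (r : ℝ) ≤ rs := by exact_mod_cast hrs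
  have hc := roundConf_pos hδ hr
  have hc1 := (roundConf_le hδ hr).trans hδ1
  have hlog : Real.log (4 / roundConf δ' r) ≤ Real.log (7 * rs ^ 2 / δ') := by
    apply Real.log_le_log (by positivity)
    have : 4 / roundConf δ' r = 4 * Real.pi ^ 2 / 6 * r ^ 2 / δ' := by
      unfold roundConf
      have := Real.pi_pos
      field_simp
    rw [this]
    gcongr
    linarith [pi_sq_lt_ten]
  have hlog0 : 0 ≤ Real.log (4 / roundConf δ' r) :=
    Real.log_nonneg ((one_le_div hc).2 (by linarith))
  have hlog1 : 1 ≤ Real.log (7 * rs ^ 2 / δ') := by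
    refine log_seven_bounds.1.trans (Real.log_le_log (by norm_num) ?_)
    have h2 : (1 : ℝ) ≤ (rs : ℝ) ^ 2 := one_le_pow₀ (hr'.trans hrs')
    rw [le_div_iff₀ hδ]
    nlinarith
  have h4 : (1 : ℝ) ≤ 4 ^ (r + 1) := one_le_pow₀ (by norm_num)
  have hwidth : width r ^ 2 = (4 ^ (r + 1))⁻¹ := by
    unfold width
    rw [← pow_mul, mul_comm, pow_mul, ← inv_pow]
    norm_num
  have hceil := (Nat.ceil_lt_add_one (a := 8 * Real.log (4 / roundConf δ' r) / width r ^ 2)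
    (by positivity)).le
  rw [hwidth, div_inv_eq_mul] at hceil
  have hbs : (batchSize δ' r : ℝ) ≤ 8 * Real.log (4 / roundConf δ' r) * 4 ^ (r + 1) + 1 := by
    unfold batchSize
    rw [hwidth, div_inv_eq_mul]
    exact hceil
  have h5 : 8 * Real.log (4 / roundConf δ' r) * 4 ^ (r + 1) ≤
      8 * Real.log (7 * rs ^ 2 / δ') * 4 ^ (r + 1) := by gcongr
  have h6 : 1 ≤ Real.log (7 * rs ^ 2 / δ') * 4 ^ (r + 1) :=
    one_le_mul_of_one_le_of_one_le hlog1 h4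
  linarith

/-- A geometric sum: `48` is exactly the constant for which `48 + 9 * 16 = 48 * 4` closes the
induction. -/
lemma duelBudget_le {δ' : ℝ} (hδ : 0 < δ') (hδ1 : δ' ≤ 1) {rs : ℕ} (hrs : 1 ≤ rs) :
    (duelBudget δ' (rs + 1) : ℝ) ≤ 48 * Real.log (7 * rs ^ 2 / δ') * 4 ^ rs := by
  have hrs' : (1 : ℝ) ≤ rs := by exact_mod_cast hrs
  have hlog0 : 0 ≤ Real.log (7 * rs ^ 2 / δ') := by
    apply Real.log_nonneg
    have h2 : (1 : ℝ) ≤ (rs : ℝ) ^ 2 := one_le_pow₀ hrs'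
    rw [le_div_iff₀ hδ]
    nlinarith
  have key : ∀ r ≤ rs, (duelBudget δ' (r + 1) : ℝ) ≤ 48 * Real.log (7 * rs ^ 2 / δ') * 4 ^ r := by
    intro r
    induction r with
    | zero =>
      intro _
      simpa [duelBudget] using hlog0
    | succ r ih =>
      intro hr
      have h1 := ih (by omega)
      have h2 := batchSize_le hδ hδ1 (Nat.succ_pos r) hr
      rw [duelBudget_succ _ (Nat.succ_pos r)]
      push_cast
      rw [Nat.succ_eq_add_one] at h2
      calc _ ≤ 48 * Real.log (7 * rs ^ 2 / δ') * 4 ^ r +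
            9 * Real.log (7 * rs ^ 2 / δ') * 4 ^ (r + 1 + 1) := add_le_add h1 h2
        _ = _ := by ring
  exact key rs le_rfl

/-! ### Numerical estimates of the regret bound -/

lemma third_le_log_half {K : ℕ} (hK : 3 ≤ K) : 1 / 3 ≤ Real.log ((K : ℝ) / 2) := by
  have hK' : (3 : ℝ) ≤ K := by exact_mod_cast hK
  have h := Real.one_sub_inv_le_log_of_pos (x := (3 / 2 : ℝ)) (by norm_num)
  have h2 : Real.log (3 / 2) ≤ Real.log ((K : ℝ) / 2) :=
    Real.log_le_log (by norm_num) (by linarith)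
  norm_num at h h2 ⊢
  linarith

/-- Here `x` is `log rs`, `y` is `log log (1 / Δ)` and `l` is `log (D / δ)`. As `l ≥ log 2`, it
compensates `log log 2 ≥ -0.4`, so `y + l ≥ x + 0.4 l`; and `log (K / 2) ≥ 1 / 3` lets the product
absorb the separate terms. -/
lemma log_budget_le {K : ℕ} (hK : 3 ≤ K) {x y l : ℝ} (hx : 0 ≤ x) (hl : Real.log 2 ≤ l)
    (hy : x + Real.log (Real.log 2) ≤ y) :
    0 ≤ y + l ∧
      Real.log 7 + 2 * x + l + Real.log K ≤ 50 * (Real.log ((K : ℝ) / 2) * (y + l)) := by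
  have hK0 : (0 : ℝ) < K := by exact_mod_cast (by omega : 0 < K)
  have hL := third_le_log_half hK
  have hlogK : Real.log K = Real.log ((K : ℝ) / 2) + Real.log 2 := by
    rw [Real.log_div hK0.ne' two_ne_zero]
    ring
  have h1 := log_log_two_ge
  have h2 := log_two_gt
  have h3 := log_two_lt
  have h4 := log_seven_bounds.2
  rw [hlogK]
  generalize Real.log ((K : ℝ) / 2) = L at *
  have hB : x + 0.4 * l ≤ y + l := by linarith
  refine ⟨by linarith, ?_⟩
  have h5 : L * (x + 0.4 * l) ≤ L * (y + l) := by gcongr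
  have h6 : 1 / 3 * x ≤ L * x := by gcongr
  have h7 : 1 / 3 * l ≤ L * l := mul_le_mul_of_nonneg_right hL (by linarith)
  have h8 : L * 0.69 ≤ L * l := by gcongr; linarith
  linarith

/-- The term is negative only for `log (1 / Δ) < 1`. With `u = log (1 / Δ) - log 2` it is then at
least `4 exp (2 u) (u - 0.4)`, and `exp (2 u) (1 - 2 u) ≤ 1` yields `-1.6`. -/
lemma neg_log_log_div_le {Δ : ℝ} (hΔ : 0 < Δ) (hΔ1 : Δ ≤ 1 / 2) :
    -1.6 ≤ 1 / Δ ^ 2 * Real.log (Real.log (1 / Δ)) := by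
  have h2 : 2 ≤ 1 / Δ := by
    rw [le_div_iff₀ hΔ]
    linarith
  set X := Real.log (1 / Δ) with hX
  have hX2 : Real.log 2 ≤ X := Real.log_le_log two_pos h2
  have hlt := log_two_gt
  have hlt' := log_two_lt
  have hX0 : 0 < X := by linarith
  by_cases hX1 : 1 ≤ X
  · have : 0 ≤ 1 / Δ ^ 2 * Real.log X := mul_nonneg (by positivity) (Real.log_nonneg hX1)
    linarith
  push Not at hX1
  have hE : 1 / Δ ^ 2 = 4 * Real.exp (2 * (X - Real.log 2)) := by
    have h3 : Real.exp X = 1 / Δ := Real.exp_log (by positivity)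
    have h4 : Real.exp (X - Real.log 2) = 1 / Δ / 2 := by
      rw [Real.exp_sub, h3, Real.exp_log two_pos]
    rw [← Nat.cast_two (R := ℝ), Real.exp_nat_mul, Nat.cast_two, h4]
    ring
  have hlog : Real.log (Real.log 2) + (X - Real.log 2) ≤ Real.log X := by
    have h3 := Real.one_sub_inv_le_log_of_pos (x := X / Real.log 2) (by positivity)
    rw [Real.log_div hX0.ne' (by positivity), inv_div] at h3
    have h4 : X - Real.log 2 ≤ 1 - Real.log 2 / X := by
      rw [one_sub_div hX0.ne', le_div_iff₀ hX0]
      nlinarith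
    linarith
  have h5 := log_log_two_ge
  rw [hE]
  set u := X - Real.log 2 with hu
  have hu0 : 0 ≤ u := by linarith
  have h6 := Real.add_one_le_exp (-(2 * u))
  rw [Real.exp_neg] at h6
  have hEpos := Real.exp_pos (2 * u)
  have h7 := mul_le_mul_of_nonneg_right h6 hEpos.le
  rw [inv_mul_cancel₀ hEpos.ne'] at h7
  generalize Real.exp (2 * u) = E at *
  have h8 : E * (-0.4 + u) ≤ E * Real.log X := by
    gcongr
    linarith
  have h9 : 0 ≤ u * E := by positivity
  nlinarith

/-- Compare cubes: the horizon condition gives `T ≥ K L / 2` and `T ≥ K / 4` with `L = log (K / 2)`,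
hence `log (D K T) ≥ 2 L`, and the cube is at least `(K L) ^ 3 / 2`. Finally `0.7 ^ 3 < 1 / 2`. -/
lemma main_term_ge {D K T m : ℕ} (hD : 1 ≤ D) (hK : 3 ≤ K) (hT : 1 ≤ T) (hm : 1 ≤ m)
    (hTK : (K : ℝ) * Real.log ((K : ℝ) / 2) / 2 ≤ T) :
    0.7 * ((K : ℝ) * Real.log ((K : ℝ) / 2)) ≤
      (D : ℝ) ^ (2 / 3 : ℝ) * (K : ℝ) ^ (1 / 3 : ℝ) * (m : ℝ) ^ (1 / 3 : ℝ) *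
        (T : ℝ) ^ (2 / 3 : ℝ) * Real.log ((D : ℝ) * K * T) ^ (1 / 3 : ℝ) := by
  have hL := third_le_log_half hK
  have hK' : (3 : ℝ) ≤ K := by exact_mod_cast hK
  have hT' : (1 : ℝ) ≤ T := by exact_mod_cast hT
  have hD' : (1 : ℝ) ≤ D := by exact_mod_cast hD
  have hm' : (1 : ℝ) ≤ m := by exact_mod_cast hm
  have hTK4 : (K : ℝ) / 4 ≤ T := by
    rcases Nat.lt_or_ge K 4 with h | h
    · have : (K : ℝ) ≤ 4 := by exact_mod_cast h.le
      linarith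
    · have h4 : (4 : ℝ) ≤ K := by exact_mod_cast h
      have : Real.log 2 ≤ Real.log ((K : ℝ) / 2) := Real.log_le_log two_pos (by linarith)
      have := log_two_gt
      nlinarith
  have hlog : 2 * Real.log ((K : ℝ) / 2) ≤ Real.log ((D : ℝ) * K * T) := by
    rw [← Nat.cast_two (R := ℝ), ← Real.log_pow, Nat.cast_two]
    apply Real.log_le_log (by positivity)
    calc ((K : ℝ) / 2) ^ 2 = 1 * K * (K / 4) := by ring
      _ ≤ D * K * T := by gcongr
  have hlog0 : 0 ≤ Real.log ((D : ℝ) * K * T) := by linarith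
  generalize Real.log ((K : ℝ) / 2) = L at *
  rw [← pow_le_pow_iff_left₀ (by positivity) (by positivity) three_ne_zero,
    rpow_two_thirds D.cast_nonneg, rpow_two_thirds T.cast_nonneg]
  simp only [mul_pow]
  rw [rpow_one_third_pow K.cast_nonneg, rpow_one_third_pow m.cast_nonneg, rpow_one_third_pow hlog0,
    ← pow_mul, ← pow_mul, mul_comm 2 3, pow_mul, pow_mul, rpow_one_third_pow D.cast_nonneg,
    rpow_one_third_pow T.cast_nonneg]
  have hD2 : (1 : ℝ) ≤ (D : ℝ) ^ 2 := one_le_pow₀ hD'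
  have hpos : 0 ≤ (K : ℝ) ^ 3 * L ^ 3 := by positivity
  calc 0.7 ^ 3 * ((K : ℝ) ^ 3 * L ^ 3) ≤ 1 * K * 1 * (K * L / 2) ^ 2 * (2 * L) := by
        norm_num
        nlinarith
    _ ≤ _ := by gcongr

/-- The regret bound is never much smaller than its last term. -/
lemma last_term_le {D K T m : ℕ} (hD : 1 ≤ D) (hK : 3 ≤ K) (hT : 1 ≤ T) (hm : 1 ≤ m)
    {Δ Δhat δ : ℝ} (hΔ : 0 < Δ) (hΔ1 : Δ ≤ 1 / 2) (hΔhat : Δhat ∈ Set.Ioo (0 : ℝ) 1)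
    (hδ : δ = (K : ℝ) * Real.log ((K : ℝ) / 2) / (2 * Δhat * T)) (hδ1 : δ < 1) :
    (K : ℝ) * Real.log ((K : ℝ) / 2) / Δhat ≤
      10 * ((K : ℝ) * D / Δ ^ 2 * Real.log ((K : ℝ) / 2) *
          (Real.log (Real.log (1 / Δ)) + Real.log (D / δ))
        + (D : ℝ) ^ (2 / 3 : ℝ) * (K : ℝ) ^ (1 / 3 : ℝ) * (m : ℝ) ^ (1 / 3 : ℝ) *
            (T : ℝ) ^ (2 / 3 : ℝ) * Real.log ((D : ℝ) * K * T) ^ (1 / 3 : ℝ)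
        + (K : ℝ) * Real.log ((K : ℝ) / 2) / Δhat) := by
  have hL := third_le_log_half hK
  have hK' : (3 : ℝ) ≤ K := by exact_mod_cast hK
  have hT' : (1 : ℝ) ≤ T := by exact_mod_cast hT
  have hD' : (1 : ℝ) ≤ D := by exact_mod_cast hD
  have hΔ0 := hΔhat.1
  have hlast : (K : ℝ) * Real.log ((K : ℝ) / 2) ≤ (K : ℝ) * Real.log ((K : ℝ) / 2) / Δhat := by
    rw [le_div_iff₀ hΔ0]
    exact mul_le_of_le_one_right (by positivity) hΔhat.2.le
  have hTK : (K : ℝ) * Real.log ((K : ℝ) / 2) / 2 ≤ T := by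
    rw [hδ, div_lt_one (by positivity)] at hδ1
    nlinarith [hΔhat.2]
  have hδ0 : 0 < δ := by
    rw [hδ]
    positivity
  have hmain := main_term_ge hD hK hT hm hTK
  -- The first term can be negative only for `D = 1`, since `log D ≥ log 2` already outweighs `log
  -- log 2`. With `-1.6` here, `0.7` from the main term and a last term of at least `K log (K / 2)`,
  -- ten times the sum exceeds the last term.
  have hfirst : -1.6 * ((K : ℝ) * Real.log ((K : ℝ) / 2)) ≤
      (K : ℝ) * D / Δ ^ 2 * Real.log ((K : ℝ) / 2) *
          (Real.log (Real.log (1 / Δ)) + Real.log (D / δ)) := by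
    have hlogδ : Real.log D ≤ Real.log (D / δ) := by
      apply Real.log_le_log (by positivity)
      rw [le_div_iff₀ hδ0]
      nlinarith
    rcases Nat.lt_or_ge D 2 with hD2 | hD2
    · have hD1 : (D : ℝ) = 1 := by exact_mod_cast (by omega : D = 1)
      rw [hD1, Real.log_one] at hlogδ
      rw [hD1]
      have h1 := neg_log_log_div_le hΔ hΔ1
      have hKL : 0 ≤ (K : ℝ) * Real.log ((K : ℝ) / 2) := by positivity
      have h2 := mul_le_mul_of_nonneg_left h1 hKL
      have h3 : 0 ≤ 1 / Δ ^ 2 * Real.log (1 / δ) := by positivity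
      have h4 := mul_nonneg hKL h3
      calc _ ≤ _ := add_le_add h2 h4 |>.trans' (le_of_eq (by ring))
        _ = _ := by ring
    · have h1 : Real.log 2 ≤ Real.log D :=
        Real.log_le_log two_pos (by exact_mod_cast hD2)
      have h2 : Real.log (Real.log 2) ≤ Real.log (Real.log (1 / Δ)) := by
        apply Real.log_le_log (Real.log_pos one_lt_two)
        apply Real.log_le_log two_pos
        rw [le_div_iff₀ hΔ]
        linarith
      have h3 : 0 ≤ Real.log (Real.log (1 / Δ)) + Real.log (D / δ) := by
        linarith [log_log_two_ge, log_two_gt]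
      have h4 : 0 ≤ (K : ℝ) * D / Δ ^ 2 * Real.log ((K : ℝ) / 2) *
          (Real.log (Real.log (1 / Δ)) + Real.log (D / δ)) := by positivity
      have h5 : 0 ≤ (K : ℝ) * Real.log ((K : ℝ) / 2) := by positivity
      linarith
  linarith

/-! ### The regret bound -/

lemma minGap_le {D K : ℕ} (I : Instance D K) (d : Fin D) {i j : Fin K} (hij : i ≠ j) :
    I.minGap ≤ |1 / 2 - I.pref d i j| :=
  ciInf_le (Set.finite_range _).bddBelow
    (⟨(d, i, j), hij⟩ : {x : Fin D × Fin K × Fin K // x.2.1 ≠ x.2.2})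

lemma minGap_le_half {D K : ℕ} (I : Instance D K) (hD : 1 ≤ D) (hK : 2 ≤ K) :
    I.minGap ≤ 1 / 2 := by
  refine (minGap_le I ⟨0, hD⟩ (i := ⟨0, by omega⟩) (j := ⟨1, by omega⟩) (by simp)).trans ?_
  have := I.pref_mem ⟨0, hD⟩ ⟨0, by omega⟩ ⟨1, by omega⟩
  exact abs_le.2 ⟨by linarith [this.2], by linarith [this.1]⟩

/-! ### Assembling the regret bound -/

section regret

variable {D K : ℕ} [NeZero K] {R : Choices D K} {δ : ℝ} {ε : ℕ → ℝ} {I : Instance D K}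
  {w : Fin D → Fin K}

lemma expectedRegret_le_horizon (hw : ∀ d, I.IsCondorcetWinner d (w d)) {πs : PMF (Fin K)}
    (hπs : IsOptimal πs (I.score w)) (T : ℕ) :
    (fairEpsGreedy R δ ε).expectedRegret I (I.score w) πs T ≤ T := by
  refine Agent.expectedRegret_le _ I hπs T T.cast_nonneg ?_
  refine (Finset.sum_le_sum fun t _ =>
    mean_le_const _ fun h => roundRegret_le_one (fairEpsGreedy R δ ε) hw πs h).trans ?_
  simp

/-- The regret is the sum of the length of the identification phase, the contribution of the event
that it is unreliable, and the contribution of the main loop. -/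
lemma expectedRegret_le_sum (hD : 1 ≤ D) (hK : 3 ≤ K) (hw : ∀ d, I.IsCondorcetWinner d (w d))
    {πs : PMF (Fin K)} (hπs : IsOptimal πs (I.score w)) (T : ℕ) {m : ℕ}
    (hm : m = (Finset.univ.image w).card) {rs : ℕ} (hrs : 1 ≤ rs)
    (hgap : ∀ d i j, i ≠ j → width rs < |1 / 2 - I.pref d i j|) (hδ : 0 < δ) (hδ1 : δ ≤ 1)
    {c c₂ : ℝ} (hc : 0 < c) (hc1 : c ≤ 1) (hc₂ : 0 ≤ c₂)
    (hε : ∀ n : ℕ, 1 ≤ n → c * exploreOrder D K m n ≤ ε n ∧ ε n ≤ c₂ * exploreOrder D K m n) :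
    (fairEpsGreedy R δ ε).expectedRegret I (I.score w) πs T ≤
      duelBudget (δ / D / K) (rs + 1) * (D * K) + T * δ +
        (c₂ + 90 / c) * ∑ n ∈ Finset.range T, exploreOrder D K m (n + 1) := by
  have hD' : (1 : ℝ) ≤ D := by exact_mod_cast hD
  have hK' : (1 : ℝ) ≤ K := by exact_mod_cast (by omega : 1 ≤ K)
  have hδ' : 0 < δ / D / K := by positivity
  have hδ1' : δ / D / K ≤ 1 := by
    rw [div_div, div_le_one (by positivity)]
    nlinarith
  have hsum0 : 0 ≤ ∑ n ∈ Finset.range T, exploreOrder D K m (n + 1) :=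
    Finset.sum_nonneg fun n _ => exploreOrder_nonneg _
  refine Agent.expectedRegret_le _ I hπs T (by positivity) ?_
  refine (sum_roundRegret_le hw πs hD hδ hδ1
    (fun h hr hI => hr.length_lt_of_identifying hw hgap hrs hδ' hδ1' hI) T).trans ?_
  rw [ENNReal.ofReal_add (by positivity) (by positivity),
    ENNReal.ofReal_add (by positivity) (by positivity), ENNReal.ofReal_mul (by positivity : 0 ≤ (T : ℝ)),
    ENNReal.ofReal_natCast, Finset.mul_sum, ENNReal.ofReal_sum_of_nonneg
      fun n _ => mul_nonneg (by positivity) (exploreOrder_nonneg _)]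
  refine add_le_add (add_le_add (le_of_eq ?_) le_rfl) (Finset.sum_le_sum fun n _ => ?_)
  · rw [← Nat.cast_mul, ← Nat.cast_mul, ENNReal.ofReal_natCast]
  · exact sum_mean_inRound_le_exploreOrder hD hK hw πs hm hc hc1 hc₂ hε
      (fun h hr hI => hr.winner_eq hw hgap hrs hδ' hδ1' hI) n T

end regret

end FairDuel

theorem theorem3 (c₁ c₂ : ℝ) (hc₁ : 0 < c₁) (hc₂ : c₁ ≤ c₂) :
    ∃ C : ℝ, 0 < C ∧
      ∀ (D K T : ℕ) [NeZero K] (_hD : 1 ≤ D) (_hK : 3 ≤ K) (_hT : 1 ≤ T)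
        (I : FairDuel.Instance D K)
        (w : Fin D → Fin K) (_hw : ∀ d, I.IsCondorcetWinner d (w d))
        (m : ℕ) (_hm : m = (Finset.univ.image w).card)
        (Δ : ℝ) (_hΔ : Δ = I.minGap) (_hΔpos : 0 < Δ)
        (Δhat : ℝ) (_hΔhat : Δhat ∈ Set.Ioo (0 : ℝ) 1)
        (δ : ℝ) (_hδ : δ = (K : ℝ) * Real.log ((K : ℝ) / 2) / (2 * Δhat * T)) (_hδ1 : δ < 1)
        (ε : ℕ → ℝ)
        (_hε : ∀ n : ℕ, 1 ≤ n → c₁ * FairDuel.exploreOrder D K m n ≤ ε n ∧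
          ε n ≤ c₂ * FairDuel.exploreOrder D K m n)
        (R : FairDuel.Choices D K)
        (πs : PMF (Fin K)) (_hπs : FairDuel.IsOptimal πs (I.score w)),
        (FairDuel.fairEpsGreedy R δ ε).expectedRegret I (I.score w) πs T ≤
          C * ((K : ℝ) * D / Δ ^ 2 * Real.log ((K : ℝ) / 2) *
                (Real.log (Real.log (1 / Δ)) +
                  Real.log (2 * Δhat * T * D / ((K : ℝ) * Real.log ((K : ℝ) / 2))))
              + (D : ℝ) ^ (2 / 3 : ℝ) * (K : ℝ) ^ (1 / 3 : ℝ) * (m : ℝ) ^ (1 / 3 : ℝ) *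
                  (T : ℝ) ^ (2 / 3 : ℝ) * Real.log ((D : ℝ) * K * T) ^ (1 / 3 : ℝ)
              + (K : ℝ) * Real.log ((K : ℝ) / 2) / Δhat) := by
  have hc₂' : 0 < c₂ := hc₁.trans_le hc₂
  have hc : 0 < min 1 c₁ := lt_min one_pos hc₁
  -- `2400 = 48 * 50` comes from `duelBudget_le` and `log_budget_le`; the rest is the per-round
  -- constant times the `3 / 2` of `sum_exploreOrder_le`. The lower rate constant is capped at one.
  refine ⟨2400 + 3 / 2 * (c₂ + 90 / min 1 c₁), by positivity, ?_⟩
  intro D K T _ hD hK hT I w hw m hm Δ hΔ hΔpos Δhat hΔhat δ hδ hδ1 ε hε R πs hπs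
  have hΔ1 : Δ ≤ 1 / 2 := hΔ ▸ FairDuel.minGap_le_half I hD (by omega)
  have hL := FairDuel.third_le_log_half hK
  have hK' : (3 : ℝ) ≤ K := by exact_mod_cast hK
  have hT' : (1 : ℝ) ≤ T := by exact_mod_cast hT
  have hD' : (1 : ℝ) ≤ D := by exact_mod_cast hD
  have hΔ0 := hΔhat.1
  have hm1 : 1 ≤ m := by
    rw [hm, Nat.one_le_iff_ne_zero, Finset.card_ne_zero]
    exact ⟨w ⟨0, hD⟩, Finset.mem_image_of_mem _ (Finset.mem_univ _)⟩
  have hδ0 : 0 < δ := by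
    rw [hδ]
    positivity
  have hDδ : 2 * Δhat * T * D / ((K : ℝ) * Real.log ((K : ℝ) / 2)) = D / δ := by
    rw [hδ]
    field_simp
  have hTδ : T * δ = (K : ℝ) * Real.log ((K : ℝ) / 2) / Δhat / 2 := by
    rw [hδ]
    field_simp
  rw [hDδ]
  have hlast := FairDuel.last_term_le hD hK hT hm1 hΔpos hΔ1 hΔhat hδ hδ1
  have hlast0 : 0 ≤ (K : ℝ) * Real.log ((K : ℝ) / 2) / Δhat := by positivity
  have hC : 0 ≤ 3 / 2 * (c₂ + 90 / min 1 c₁) := by positivity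
  -- For `δ ≥ 1 / 2` the horizon is at most the last term of the bound, so one unit per round
  -- suffices. Otherwise `log (D / δ) ≥ log 2`, which keeps the bracket of the first term
  -- nonnegative.
  rcases le_or_gt (1 / 2) δ with hhalf | hhalf
  · refine (FairDuel.expectedRegret_le_horizon hw hπs T).trans ?_
    have h1 : (T : ℝ) ≤ (K : ℝ) * Real.log ((K : ℝ) / 2) / Δhat := by nlinarith
    generalize (K : ℝ) * D / Δ ^ 2 * Real.log ((K : ℝ) / 2) *
      (Real.log (Real.log (1 / Δ)) + Real.log (D / δ)) + _ + _ = B at *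
    nlinarith
  obtain ⟨rs, hrs, hwidth, hpow, hlogrs⟩ := FairDuel.exists_last_round hΔpos hΔ1
  have hε' : ∀ n : ℕ, 1 ≤ n → min 1 c₁ * FairDuel.exploreOrder D K m n ≤ ε n ∧
      ε n ≤ c₂ * FairDuel.exploreOrder D K m n := fun n hn =>
    ⟨(mul_le_mul_of_nonneg_right (min_le_right _ _) (FairDuel.exploreOrder_nonneg n)).trans
      (hε n hn).1, (hε n hn).2⟩
  refine (FairDuel.expectedRegret_le_sum hD hK hw hπs T hm hrs (fun d i j hij =>
    hwidth.trans_le (hΔ ▸ FairDuel.minGap_le I d hij)) hδ0 hδ1.le hc (min_le_left _ _) hc₂'.le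
    hε').trans ?_
  have hrs' : (1 : ℝ) ≤ rs := by exact_mod_cast hrs
  have hl : Real.log 2 ≤ Real.log (D / δ) := by
    apply Real.log_le_log two_pos
    rw [le_div_iff₀ hδ0]
    linarith
  obtain ⟨hbr, hlog⟩ := FairDuel.log_budget_le hK (Real.log_nonneg hrs') hl hlogrs
  have hδ' : 0 < δ / D / K := by positivity
  have hδ1' : δ / D / K ≤ 1 := by
    rw [div_div, div_le_one (by positivity)]
    nlinarith
  have hbudget := FairDuel.duelBudget_le hδ' hδ1' hrs
  have hlogeq : Real.log (7 * rs ^ 2 / (δ / D / K)) =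
      Real.log 7 + 2 * Real.log rs + Real.log (D / δ) + Real.log K := by
    have h1 : 7 * (rs : ℝ) ^ 2 / (δ / D / K) = 7 * rs ^ 2 * (D / δ) * K := by
      field_simp
    rw [h1, Real.log_mul (by positivity) (by positivity), Real.log_mul (by positivity)
      (by positivity), Real.log_mul (by positivity) (by positivity), Real.log_pow, Nat.cast_two]
  rw [hlogeq] at hbudget
  have hfirst : (FairDuel.duelBudget (δ / D / K) (rs + 1) : ℝ) * (D * K) ≤
      2400 * ((K : ℝ) * D / Δ ^ 2 * Real.log ((K : ℝ) / 2) *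
        (Real.log (Real.log (1 / Δ)) + Real.log (D / δ))) := by
    have hR0 : 0 ≤ Real.log ((K : ℝ) / 2) *
        (Real.log (Real.log (1 / Δ)) + Real.log (D / δ)) := by positivity
    calc (FairDuel.duelBudget (δ / D / K) (rs + 1) : ℝ) * (D * K)
        ≤ 48 * (50 * (Real.log ((K : ℝ) / 2) *
          (Real.log (Real.log (1 / Δ)) + Real.log (D / δ)))) * (1 / Δ ^ 2) * (D * K) := by
          refine mul_le_mul_of_nonneg_right (hbudget.trans ?_) (by positivity)
          gcongr
      _ = _ := by ring
  have hsum := FairDuel.sum_exploreOrder_le (D := D) (K := K) (m := m) T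
  have hsecond := mul_le_mul_of_nonneg_left hsum (by positivity : 0 ≤ c₂ + 90 / min 1 c₁)
  have hfirst0 : 0 ≤ (K : ℝ) * D / Δ ^ 2 * Real.log ((K : ℝ) / 2) *
      (Real.log (Real.log (1 / Δ)) + Real.log (D / δ)) := by positivity
  have hsecond0 : 0 ≤ (D : ℝ) ^ (2 / 3 : ℝ) * (K : ℝ) ^ (1 / 3 : ℝ) * (m : ℝ) ^ (1 / 3 : ℝ) *
      (T : ℝ) ^ (2 / 3 : ℝ) * Real.log ((D : ℝ) * K * T) ^ (1 / 3 : ℝ) := by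
    have : 0 ≤ Real.log ((D : ℝ) * K * T) :=
      zero_le_one.trans (FairDuel.one_le_log hD hK hT)
    positivity
  rw [hTδ]
  generalize (K : ℝ) * D / Δ ^ 2 * Real.log ((K : ℝ) / 2) *
    (Real.log (Real.log (1 / Δ)) + Real.log (D / δ)) = X₁ at *
  generalize (D : ℝ) ^ (2 / 3 : ℝ) * (K : ℝ) ^ (1 / 3 : ℝ) * (m : ℝ) ^ (1 / 3 : ℝ) *
    (T : ℝ) ^ (2 / 3 : ℝ) * Real.log ((D : ℝ) * K * T) ^ (1 / 3 : ℝ) = X₂ at *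
  generalize (K : ℝ) * Real.log ((K : ℝ) / 2) / Δhat = X₃ at *
  have e1 : 0 ≤ 3 / 2 * (c₂ + 90 / min 1 c₁) * X₁ := mul_nonneg hC hfirst0
  have e3 : 0 ≤ 3 / 2 * (c₂ + 90 / min 1 c₁) * X₃ := mul_nonneg hC hlast0
  linarith

end
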